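/- Let $\Bbbk$ be a field of characteristic zero and let $\Gamma$ be an abelian group (for instance $\Gamma=\mathbb Z$). **Graded objects.** A $\Gamma$-graded algebra is a vector space $A=\bigoplus_{i\in\Gamma}A_i$ with all $A_i$ finite-dimensional and a bilinear product such that $A_iA_j\subseteq A_{i+j}$. It is a $\Gamma$-graded perm algebra if $a(bc)=(ab)c=(ba)c$. A *quadratic $\Gamma$-graded perm algebra* $(B,\cdot,\varpi)$ is a $\Gamma$-graded perm algebra with a nondegenerate antisymmetric bilinear form $\varpi$ that is invariant, $\varpi(b_1b_2,b_3)=\varpi(b_1,b_2b_3-b_3b_2)$, and graded: there is $m\in\Gamma$ with $\varpi(B_i,B_j)=0$ whenever $i+j+m\ne0$. The completed tensor product is $U\hat\otimes V=\prod_{i,j}U_i\otimes V_j$, and $\hat\tau$ is the completed flip. Let $\nu_\varpi:B\to B\hat\otimes B$ be the (unique) linear map with $\hat\varpi(\nu_\varpi(b),e\otimes f)=-\varpi(b,ef)$ for all $b,e,f\in B$, where $\hat\varpi(\sum x_i\otimes y_j,e\otimes f)=\sum\varpi(x_i,e)\varpi(y_j,f)$. A *completed ASI bialgebra* $(A,*,\Delta)$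 is a $\Gamma$-graded associative algebra $(A,*)$ with a linear map $\Delta:A\to A\hat\otimes A$ such that both sides of $(\Delta\hat\otimes\mathrm{id})\Delta=(\mathrm{id}\hat\otimes\Delta)\Delta$ are well defined (finitely many contributions in each tridegree) and equal, and, with $\mathfrak l_A(a)(x)=a*x$ and $\mathfrak r_A(a)(x)=x*a$, for all $a_1,a_2\in A$: $$\Delta(a_1*a_2)=(\mathfrak r_A(a_2)\hat\otimes\mathrm{id})\Delta(a_1)+(\mathrm{id}\hat\otimes\mathfrak l_A(a_1))\Delta(a_2),$$ $$(\mathfrak l_A(a_1)\hat\otimes\mathrm{id}-\mathrm{id}\hat\otimes\mathfrak r_A(a_1))\Delta(a_2)=\hat\tau\big((\mathrm{id}\hat\otimes\mathfrak r_A(a_2)-\mathfrak l_A(a_2)\hat\otimes\mathrm{id})\Delta(a_1)\big).$$ **Dendriform $D$-bialgebras.** A dendriform algebra $(D,\prec,\succ)$ satisfies $(x\prec y)\prec z=x\prec(y\prec z+y\succ z)$, $(x\succ y)\prec z=x\succ(y\prec z)$, $x\succ(y\succ z)=(x\prec y+x\succ y)\succ z$. A dendriform coalgebra $(D,\theta_\prec,\theta_\succ)$,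 with $\theta_\prec,\theta_\succ:D\to D\otimes D$ linear, satisfies $(\theta_\prec\otimes\mathrm{id})\theta_\prec=(\mathrm{id}\otimes(\theta_\prec+\theta_\succ))\theta_\prec$, $(\theta_\succ\otimes\mathrm{id})\theta_\prec=(\mathrm{id}\otimes\theta_\prec)\theta_\succ$, $(\mathrm{id}\otimes\theta_\succ)\theta_\succ=((\theta_\prec+\theta_\succ)\otimes\mathrm{id})\theta_\succ$. Write $\mathfrak l_\prec(x)(y)=x\prec y$, $\mathfrak r_\prec(x)(y)=y\prec x$, likewise for $\succ$, and $\mathfrak l=\mathfrak l_\prec+\mathfrak l_\succ$, $\mathfrak r=\mathfrak r_\prec+\mathfrak r_\succ$, $\theta=\theta_\prec+\theta_\succ$, $x\cdot_Dy=x\prec y+x\succ y$; let $\tau$ be the flip. A *dendriform $D$-bialgebra* is a dendriform algebra and coalgebra $(D,\prec,\succ,\theta_\prec,\theta_\succ)$ with, for all $x,y\in D$: 1. $\theta_\prec(x\cdot_Dy)=(\mathrm{id}\otimes\mathfrak l_\succ(x))\theta_\prec(y)+(\mathfrak r(y)\otimes\mathrm{id})\theta_\prec(x)$; 2. $\theta_\succ(x\cdot_Dy)=(\mathrm{id}\otimes\mathfrak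 l(x))\theta_\succ(y)+(\mathfrak r_\prec(y)\otimes\mathrm{id})\theta_\succ(x)$; 3. $\theta(x\prec y)=(\mathrm{id}\otimes\mathfrak l_\prec(x))\theta_\succ(y)+(\mathfrak r_\prec(y)\otimes\mathrm{id})\theta(x)$; 4. $\theta(x\succ y)=(\mathrm{id}\otimes\mathfrak l_\succ(x))\theta(y)+(\mathfrak r_\succ(y)\otimes\mathrm{id})\theta_\prec(x)$; 5. $(\mathfrak l(x)\otimes\mathrm{id}-\mathrm{id}\otimes\mathfrak r_\prec(x))\theta_\prec(y)=-\tau\big((\mathfrak l_\succ(y)\otimes\mathrm{id}-\mathrm{id}\otimes\mathfrak r(y))\theta_\succ(x)\big)$; 6. $(\mathfrak l_\succ(y)\otimes\mathrm{id}-\mathrm{id}\otimes\mathfrak r_\prec(y))\theta(x)=\tau\big((\mathrm{id}\otimes\mathfrak r_\succ(x))\theta_\succ(y)-(\mathfrak l_\prec(x)\otimes\mathrm{id})\theta_\prec(y)\big)$. **Theorem.** Let $D$ be a finite-dimensional vector space with bilinear operations $\prec,\succ$ and linear maps $\theta_\prec,\theta_\succ:D\to D\otimes D$. For a quadratic $\Gamma$-graded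 perm algebra $(B,\cdot,\varpi)$, grade $D\otimes B$ by the subspaces $D\otimes B_i$ and put $$(d_1\otimes b_1)*(d_2\otimes b_2)=(d_1\succ d_2)\otimes b_1b_2+(d_1\prec d_2)\otimes b_2b_1,\qquad \Delta(d\otimes b)=\theta_\succ(d)\bullet\nu_\varpi(b)+\theta_\prec(d)\bullet\hat\tau(\nu_\varpi(b)),$$ where $(d'\otimes d'')\bullet\sum x_i\otimes y_j=\sum(d'\otimes x_i)\otimes(d''\otimes y_j)$. (a) If $(D,\prec,\succ,\theta_\prec,\theta_\succ)$ is a dendriform $D$-bialgebra, then $(D\otimes B,*,\Delta)$ is a completed ASI bialgebra, for every abelian group $\Gamma$ and every quadratic $\Gamma$-graded perm algebra $(B,\cdot,\varpi)$ (in particular for every quadratic $\mathbb Z$-graded one). (b) Let $B=\{f_1\partial_1+f_2\partial_2\mid f_1,f_2\in\Bbbk[x_1^{\pm},x_2^{\pm}]\}$ with $(x^p\partial_s)\cdot(x^q\partial_t)=x_sx^{p+q}\partial_t$ and the antisymmetric form with $\varpi(x^p\partial_2,x^q\partial_1)=-\varpi(x^q\partial_1,x^p\partial_2)=\delta_{p+q,0}$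 and $\varpi(x^p\partial_s,x^q\partial_s)=0$ for $p,q\in\mathbb Z^2$, $s,t\in\{1,2\}$, graded by $\mathbb Z^2$ with $\deg(x^p\partial_1)=p+(1,0)$ and $\deg(x^p\partial_2)=p+(0,1)$. Then $(D\otimes B,*,\Delta)$ is a completed ASI bialgebra if and only if $(D,\prec,\succ,\theta_\prec,\theta_\succ)$ is a dendriform $D$-bialgebra. -/

import Mathlib

open scoped TensorProduct DirectSum

noncomputable section

namespace DendriformASI

universe u v w

/-! ### Graded spaces and completed tensor products

A grading of a vector space `A` by `Γ` is a family `𝒜 : Γ → Submodule k A` with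
`DirectSum.IsInternal 𝒜`. -/

section Completed

variable {k : Type u} [Field k] {Γ : Type v} [DecidableEq Γ]

/-- The completed tensor product `U ⊗̂ V = ∏_{i,j} U_i ⊗ V_j`. -/
abbrev CTensor {U V : Type*} [AddCommGroup U] [Module k U] [AddCommGroup V] [Module k V]
    (𝒰 : Γ → Submodule k U) (𝒱 : Γ → Submodule k V) : Type _ :=
  ∀ i j : Γ, (𝒰 i) ⊗[k] (𝒱 j)

variable {A : Type w} [AddCommGroup A] [Module k A]

open Classical in
/-- The projection `A → A_i` of a graded vector space `A = ⨁ A_i`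
(by convention zero if `𝒜` is not a grading). -/
def gproj (𝒜 : Γ → Submodule k A) (i : Γ) : A →ₗ[k] 𝒜 i :=
  if h : DirectSum.IsInternal 𝒜 then
    (DirectSum.component k Γ (fun i => 𝒜 i) i) ∘ₗ
      (LinearEquiv.ofBijective (DirectSum.coeLinearMap 𝒜) h).symm.toLinearMap
  else 0

/-- The completed tensor product of maps
`f ⊗̂ g : Σ_{i,j} u_i ⊗ v_j ↦ Σ_{i,j} f(u_i) ⊗ g(v_j)`. The component in bidegree `(i, j)` of the
right-hand side is the sum over all `(i', j')` of the image of the `(i', j')` component; it is used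
below only when one of `f`, `g` is the identity and the other one is a left or right multiplication
of a graded algebra, and then only finitely many terms do not vanish. -/
def ctMap (𝒜 : Γ → Submodule k A) (f g : A →ₗ[k] A) (X : CTensor 𝒜 𝒜) : CTensor 𝒜 𝒜 :=
  fun i j => ∑ᶠ p : Γ × Γ,
    TensorProduct.map (gproj 𝒜 i ∘ₗ f ∘ₗ (𝒜 p.1).subtype) (gproj 𝒜 j ∘ₗ g ∘ₗ (𝒜 p.2).subtype)
      (X p.1 p.2)

/-- The completed twist `τ̂`. -/
def ctTwist (𝒜 : Γ → Submodule k A) (X : CTensor 𝒜 𝒜) : CTensor 𝒜 𝒜 :=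
  fun i j => TensorProduct.comm k (𝒜 j) (𝒜 i) (X j i)

/-- The component in `A_i ⊗ A_j` of a completed comultiplication. -/
def ctComponent (𝒜 : Γ → Submodule k A) (Δ : A →ₗ[k] CTensor 𝒜 𝒜) (i j : Γ) :
    A →ₗ[k] (𝒜 i) ⊗[k] (𝒜 j) :=
  LinearMap.proj j ∘ₗ LinearMap.proj i ∘ₗ Δ

/-- The `l`-th contribution to the component of `(Δ ⊗̂ id) X` in `A_i ⊗ A_j ⊗ A_n`: it comes from
the component of `X` in `A_l ⊗ A_n`. -/
def ctLeftTerm (𝒜 : Γ → Submodule k A) (Δ : A →ₗ[k] CTensor 𝒜 𝒜) (X : CTensor 𝒜 𝒜)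
    (i j n l : Γ) : (𝒜 i) ⊗[k] ((𝒜 j) ⊗[k] (𝒜 n)) :=
  TensorProduct.assoc k (𝒜 i) (𝒜 j) (𝒜 n)
    (TensorProduct.map (ctComponent 𝒜 Δ i j ∘ₗ (𝒜 l).subtype) LinearMap.id (X l n))

/-- The `l`-th contribution to the component of `(id ⊗̂ Δ) X` in `A_i ⊗ A_j ⊗ A_n`: it comes from
the component of `X` in `A_i ⊗ A_l`. -/
def ctRightTerm (𝒜 : Γ → Submodule k A) (Δ : A →ₗ[k] CTensor 𝒜 𝒜) (X : CTensor 𝒜 𝒜)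
    (i j n l : Γ) : (𝒜 i) ⊗[k] ((𝒜 j) ⊗[k] (𝒜 n)) :=
  TensorProduct.map LinearMap.id (ctComponent 𝒜 Δ j n ∘ₗ (𝒜 l).subtype) (X i l)

/-- Completed coassociativity `(Δ ⊗̂ id) Δ = (id ⊗̂ Δ) Δ`, including that both sides make sense,
that is, that in every tridegree only finitely many terms contribute. -/
structure IsCompletedCoassociative (𝒜 : Γ → Submodule k A) (Δ : A →ₗ[k] CTensor 𝒜 𝒜) :
    Prop where
  finite_left : ∀ (a : A) (i j n : Γ), {l | ctLeftTerm 𝒜 Δ (Δ a) i j n l ≠ 0}.Finite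
  finite_right : ∀ (a : A) (i j n : Γ), {l | ctRightTerm 𝒜 Δ (Δ a) i j n l ≠ 0}.Finite
  coassoc : ∀ (a : A) (i j n : Γ),
    ∑ᶠ l : Γ, ctLeftTerm 𝒜 Δ (Δ a) i j n l = ∑ᶠ l : Γ, ctRightTerm 𝒜 Δ (Δ a) i j n l

variable [AddCommGroup Γ]

/-- A graded algebra (with no axiom on the product besides bilinearity and compatibility with the
grading) all of whose homogeneous components are finite-dimensional. -/
structure IsGradedAlg (𝒜 : Γ → Submodule k A) (mul : A →ₗ[k] A →ₗ[k] A) : Prop where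
  internal : DirectSum.IsInternal 𝒜
  finite : ∀ i, FiniteDimensional k (𝒜 i)
  mul_mem : ∀ i j, ∀ a ∈ 𝒜 i, ∀ b ∈ 𝒜 j, mul a b ∈ 𝒜 (i + j)

/-- A graded associative algebra. -/
structure IsGradedAssociative (𝒜 : Γ → Submodule k A) (mul : A →ₗ[k] A →ₗ[k] A) : Prop
    extends IsGradedAlg 𝒜 mul where
  assoc : ∀ a b c, mul (mul a b) c = mul a (mul b c)

/-- A graded perm algebra. -/
structure IsGradedPerm (𝒜 : Γ → Submodule k A) (mul : A →ₗ[k] A →ₗ[k] A) : Prop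
    extends IsGradedAlg 𝒜 mul where
  assoc : ∀ a b c, mul a (mul b c) = mul (mul a b) c
  perm : ∀ a b c, mul (mul a b) c = mul (mul b a) c

/-- A quadratic graded perm algebra: a graded perm algebra with an antisymmetric, invariant,
nondegenerate, graded bilinear form. -/
structure IsQuadraticGradedPerm (𝒜 : Γ → Submodule k A) (mul : A →ₗ[k] A →ₗ[k] A)
    (ϖ : A →ₗ[k] A →ₗ[k] k) : Prop extends IsGradedPerm 𝒜 mul where
  antisymm : ∀ a b, ϖ a b = - ϖ b a
  invariant : ∀ a b c, ϖ (mul a b) c = ϖ a (mul b c - mul c b)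
  nondegenerate : ϖ.Nondegenerate
  graded : ∃ m : Γ, ∀ i j, i + j + m ≠ 0 → ∀ a ∈ 𝒜 i, ∀ b ∈ 𝒜 j, ϖ a b = 0

/-- A completed antisymmetric infinitesimal (ASI) bialgebra `(A, *, Δ)`: here
`mul.flip a` is the right multiplication and `mul a` the left multiplication by `a`. -/
structure IsCompletedASIBialgebra (𝒜 : Γ → Submodule k A) (mul : A →ₗ[k] A →ₗ[k] A)
    (Δ : A →ₗ[k] CTensor 𝒜 𝒜) : Prop where
  graded_assoc : IsGradedAssociative 𝒜 mul
  coassoc : IsCompletedCoassociative 𝒜 Δ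
  comul_mul : ∀ a₁ a₂ : A, Δ (mul a₁ a₂) =
    ctMap 𝒜 (mul.flip a₂) LinearMap.id (Δ a₁) + ctMap 𝒜 LinearMap.id (mul a₁) (Δ a₂)
  antisymm : ∀ a₁ a₂ : A,
    ctMap 𝒜 (mul a₁) LinearMap.id (Δ a₂) - ctMap 𝒜 LinearMap.id (mul.flip a₁) (Δ a₂) =
      ctTwist 𝒜 (ctMap 𝒜 LinearMap.id (mul.flip a₂) (Δ a₁)
        - ctMap 𝒜 (mul a₂) LinearMap.id (Δ a₁))

/-- The contribution of the component of `X` in `A_i ⊗ A_j`, `p = (i, j)`, to `ϖ̂(X, e ⊗ f)`. -/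
def ctPairingTerm (𝒜 : Γ → Submodule k A) (ϖ : A →ₗ[k] A →ₗ[k] k) (X : CTensor 𝒜 𝒜)
    (e f : A) (p : Γ × Γ) : k :=
  LinearMap.mul' k k (TensorProduct.map (ϖ.flip e ∘ₗ (𝒜 p.1).subtype)
    (ϖ.flip f ∘ₗ (𝒜 p.2).subtype) (X p.1 p.2))

/-- The pairing `ϖ̂(Σ x_i ⊗ y_j, e ⊗ f) = Σ ϖ(x_i, e) ϖ(y_j, f)`
(a finite sum when `ϖ` is graded). -/
def ctPairing (𝒜 : Γ → Submodule k A) (ϖ : A →ₗ[k] A →ₗ[k] k) (X : CTensor 𝒜 𝒜)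
    (e f : A) : k :=
  ∑ᶠ p : Γ × Γ, ctPairingTerm 𝒜 ϖ X e f p

end Completed

section Coproduct

theorem ctPairingTerm_add_left {k : Type u} [Field k] {Γ : Type v}
    {B : Type w} [AddCommGroup B] [Module k B] {ℬ : Γ → Submodule k B} {ϖ : B →ₗ[k] B →ₗ[k] k}
    (X : CTensor ℬ ℬ) (e e' f : B) (p : Γ × Γ) :
    ctPairingTerm ℬ ϖ X (e + e') f p = ctPairingTerm ℬ ϖ X e f p + ctPairingTerm ℬ ϖ X e' f p := by
  simp [ctPairingTerm, LinearMap.add_comp, TensorProduct.map_add_left]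

theorem ctPairingTerm_add_right {k : Type u} [Field k] {Γ : Type v}
    {B : Type w} [AddCommGroup B] [Module k B] {ℬ : Γ → Submodule k B} {ϖ : B →ₗ[k] B →ₗ[k] k}
    (X : CTensor ℬ ℬ) (e f f' : B) (p : Γ × Γ) :
    ctPairingTerm ℬ ϖ X e (f + f') p = ctPairingTerm ℬ ϖ X e f p + ctPairingTerm ℬ ϖ X e f' p := by
  simp [ctPairingTerm, LinearMap.add_comp, TensorProduct.map_add_right]

variable {k : Type u} [Field k] {Γ : Type v} [AddCommGroup Γ] [DecidableEq Γ]
  {B : Type w} [AddCommGroup B] [Module k B]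
  {ℬ : Γ → Submodule k B} {mul : B →ₗ[k] B →ₗ[k] B} {ϖ : B →ₗ[k] B →ₗ[k] k}

/-- The pairing of `B_i` with `B_j`. -/
def pairHom (ℬ : Γ → Submodule k B) (ϖ : B →ₗ[k] B →ₗ[k] k) (i j : Γ) :
    ℬ i →ₗ[k] Module.Dual k (ℬ j) :=
  (ϖ.domRestrict₁₂ (ℬ i) (ℬ j))

theorem pairHom_bijective (h : IsQuadraticGradedPerm ℬ mul ϖ) {m : Γ}
    (hm : ∀ i j, i + j + m ≠ 0 → ∀ a ∈ ℬ i, ∀ b ∈ ℬ j, ϖ a b = 0) (i : Γ) :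
    Function.Bijective (pairHom ℬ ϖ i (-m - i)) := by
  have inj : ∀ i j : Γ, i + j + m = 0 → Function.Injective (pairHom ℬ ϖ i j) := by
    intro i j hij
    rw [← LinearMap.ker_eq_bot, LinearMap.ker_eq_bot']
    intro x hx
    have : (x : B) = 0 := by
      apply h.nondegenerate.1
      intro y
      have hy : y ∈ iSup ℬ := by
        rw [h.internal.submodule_iSup_eq_top]; trivial
      induction hy using Submodule.iSup_induction' with
      | mem l y hy =>
        by_cases hl : l = j
        · subst hl
          exact congrArg (fun φ => φ ⟨y, hy⟩) hx
        · refine hm i l ?_ _ x.2 _ hy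
          intro h0
          apply hl
          have : i + l + m = i + j + m := by rw [h0, hij]
          simpa using this
      | zero => simp
      | add y z _ _ hy hz => simp [hy, hz]
    exact Subtype.ext this
  have := h.finite
  have h1 := inj i (-m - i) (by abel)
  have h2 := inj (-m - i) i (by abel)
  have d1 := LinearMap.finrank_le_finrank_of_injective h1
  have d2 := LinearMap.finrank_le_finrank_of_injective h2
  rw [Subspace.dual_finrank_eq] at d1 d2
  refine ⟨h1, ?_⟩
  exact (LinearMap.injective_iff_surjective_of_finrank_eq_finrank
    (by rw [Subspace.dual_finrank_eq]; omega)).1 h1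

/-- The pairing of `B_i ⊗ B_j` with `B_{-m-i} ⊗ B_{-m-j}`, as an isomorphism. -/
def pairEquiv (h : IsQuadraticGradedPerm ℬ mul ϖ) {m : Γ}
    (hm : ∀ i j, i + j + m ≠ 0 → ∀ a ∈ ℬ i, ∀ b ∈ ℬ j, ϖ a b = 0) (i j : Γ) :
    (ℬ i) ⊗[k] (ℬ j) ≃ₗ[k] Module.Dual k ((ℬ (-m - i)) ⊗[k] (ℬ (-m - j))) :=
  haveI := h.finite
  (TensorProduct.congr (LinearEquiv.ofBijective _ (pairHom_bijective h hm i))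
    (LinearEquiv.ofBijective _ (pairHom_bijective h hm j))).trans
    (TensorProduct.dualDistribEquiv k (ℬ (-m - i)) (ℬ (-m - j)))

theorem pairEquiv_apply (h : IsQuadraticGradedPerm ℬ mul ϖ) {m : Γ}
    (hm : ∀ i j, i + j + m ≠ 0 → ∀ a ∈ ℬ i, ∀ b ∈ ℬ j, ϖ a b = 0) (i j : Γ)
    (X : CTensor ℬ ℬ) (e : ℬ (-m - i)) (f : ℬ (-m - j)) :
    pairEquiv h hm i j (X i j) (e ⊗ₜ f) = ctPairingTerm ℬ ϖ X e f (i, j) := by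
  unfold ctPairingTerm
  dsimp only
  generalize X i j = t
  induction t using TensorProduct.induction_on with
  | zero => simp
  | tmul x y =>
    simp [pairEquiv, pairHom, TensorProduct.dualDistribEquiv,
      TensorProduct.dualDistribEquivOfBasis]
    rfl
  | add x y hx hy => rw [map_add, LinearMap.add_apply, hx, hy, map_add, map_add]

theorem ctPairingTerm_eq_zero {m : Γ}
    (hm : ∀ i j, i + j + m ≠ 0 → ∀ a ∈ ℬ i, ∀ b ∈ ℬ j, ϖ a b = 0)
    (X : CTensor ℬ ℬ) {s t : Γ} {e f : B} (he : e ∈ ℬ s) (hf : f ∈ ℬ t) {p : Γ × Γ}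
    (hp : p ≠ (-m - s, -m - t)) : ctPairingTerm ℬ ϖ X e f p = 0 := by
  obtain ⟨i, j⟩ := p
  unfold ctPairingTerm
  by_cases hi : i = -m - s
  · have hj : j + t + m ≠ 0 := by
      intro h0
      apply hp
      rw [hi, eq_sub_of_add_eq (eq_neg_of_add_eq_zero_left h0)]
    have : ϖ.flip f ∘ₗ (ℬ j).subtype = 0 := by
      ext y; exact hm j t hj _ y.2 _ hf
    simp [this]
  · have hi' : i + s + m ≠ 0 := by
      intro h0
      exact hi (eq_sub_of_add_eq (eq_neg_of_add_eq_zero_left h0))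
    have : ϖ.flip e ∘ₗ (ℬ i).subtype = 0 := by
      ext y; exact hm i s hi' _ y.2 _ he
    simp [this]

theorem ctPairing_homogeneous {m : Γ}
    (hm : ∀ i j, i + j + m ≠ 0 → ∀ a ∈ ℬ i, ∀ b ∈ ℬ j, ϖ a b = 0)
    (X : CTensor ℬ ℬ) {s t : Γ} {e f : B} (he : e ∈ ℬ s) (hf : f ∈ ℬ t) :
    ctPairing ℬ ϖ X e f = ctPairingTerm ℬ ϖ X e f (-m - s, -m - t) :=
  finsum_eq_single _ _ fun _ hp => ctPairingTerm_eq_zero hm X he hf hp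

/-- A quadratic graded perm algebra has exactly one linear map `ν : B → B ⊗̂ B` with
`ϖ̂(ν(b), e ⊗ f) = -ϖ(b, e f)`. -/
theorem existsUnique_coproduct (h : IsQuadraticGradedPerm ℬ mul ϖ) :
    ∃! ν : B →ₗ[k] CTensor ℬ ℬ, ∀ b e f, ctPairing ℬ ϖ (ν b) e f = - ϖ b (mul e f) := by
  obtain ⟨m, hm⟩ := h.graded
  -- the functional `e ⊗ f ↦ -ϖ(b, e f)`
  let F : ∀ i j : Γ, B →ₗ[k] Module.Dual k ((ℬ i) ⊗[k] (ℬ j)) := fun i j =>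
    { toFun := fun b => - ((ϖ b) ∘ₗ TensorProduct.lift (mul.domRestrict₁₂ (ℬ i) (ℬ j)))
      map_add' := fun b c => by ext; simp [add_comm]
      map_smul' := fun r b => by ext; simp }
  refine ⟨LinearMap.pi fun i => LinearMap.pi fun j =>
    (pairEquiv h hm i j).symm.toLinearMap ∘ₗ F (-m - i) (-m - j), ?_, ?_⟩
  · intro b e f
    set X : CTensor ℬ ℬ := (LinearMap.pi fun i => LinearMap.pi fun j =>
      (pairEquiv h hm i j).symm.toLinearMap ∘ₗ F (-m - i) (-m - j)) b with hX
    suffices H : {p | ctPairingTerm ℬ ϖ X e f p ≠ 0}.Finite ∧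
        ctPairing ℬ ϖ X e f = - ϖ b (mul e f) from H.2
    have he : e ∈ iSup ℬ := by rw [h.internal.submodule_iSup_eq_top]; trivial
    have hf : f ∈ iSup ℬ := by rw [h.internal.submodule_iSup_eq_top]; trivial
    induction he using Submodule.iSup_induction' with
    | mem s e he =>
      induction hf using Submodule.iSup_induction' with
      | mem t f hf =>
        constructor
        · refine (Set.finite_singleton (-m - s, -m - t)).subset ?_
          intro p hp
          by_contra hne
          exact hp (ctPairingTerm_eq_zero hm X he hf hne)
        · rw [ctPairing_homogeneous hm X he hf]
          have hs : -m - (-m - s) = s := by abel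
          have ht : -m - (-m - t) = t := by abel
          have := pairEquiv_apply h hm (-m - s) (-m - t) X ⟨e, by rwa [hs]⟩ ⟨f, by rwa [ht]⟩
          rw [← this, hX]
          simp [F]
          rfl
      | zero => simp [ctPairing, ctPairingTerm]
      | add f f' _ _ hf hf' =>
        refine ⟨(hf.1.union hf'.1).subset ?_, ?_⟩
        · intro p hp
          by_contra hne
          simp only [Set.mem_union, Set.mem_ofPred_eq, not_or, not_not] at hne
          exact hp (by rw [ctPairingTerm_add_right, hne.1, hne.2, add_zero])
        · have : ctPairing ℬ ϖ X e (f + f') = ctPairing ℬ ϖ X e f + ctPairing ℬ ϖ X e f' := by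
            unfold ctPairing
            rw [← finsum_add_distrib hf.1 hf'.1]
            exact finsum_congr fun p => ctPairingTerm_add_right X e f f' p
          rw [this, hf.2, hf'.2, map_add, map_add, neg_add]
    | zero => simp [ctPairing, ctPairingTerm]
    | add e e' _ _ he he' =>
      refine ⟨(he.1.union he'.1).subset ?_, ?_⟩
      · intro p hp
        by_contra hne
        simp only [Set.mem_union, Set.mem_ofPred_eq, not_or, not_not] at hne
        exact hp (by rw [ctPairingTerm_add_left, hne.1, hne.2, add_zero])
      · have : ctPairing ℬ ϖ X (e + e') f = ctPairing ℬ ϖ X e f + ctPairing ℬ ϖ X e' f := by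
          unfold ctPairing
          rw [← finsum_add_distrib he.1 he'.1]
          exact finsum_congr fun p => ctPairingTerm_add_left X e e' f p
        rw [this, he.2, he'.2, map_add, LinearMap.add_apply, map_add, neg_add]
  · intro ν hν
    refine LinearMap.ext fun b => funext fun i => funext fun j => ?_
    change ν b i j = (pairEquiv h hm i j).symm (F (-m - i) (-m - j) b)
    rw [LinearEquiv.eq_symm_apply]
    refine TensorProduct.ext' fun e f => ?_
    rw [pairEquiv_apply]
    have h1 := ctPairing_homogeneous hm (ν b) e.2 f.2
    have hi : -m - (-m - i) = i := by abel
    have hj : -m - (-m - j) = j := by abel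
    rw [hi, hj] at h1
    rw [← h1, hν]
    simp [F]
    rfl

/-- The coproduct `ν_ϖ : B → B ⊗̂ B` of a quadratic graded perm algebra, defined by
`ϖ̂(ν_ϖ(b), e ⊗ f) = -ϖ(b, e f)`. -/
def inducedCoproduct (h : IsQuadraticGradedPerm ℬ mul ϖ) : B →ₗ[k] CTensor ℬ ℬ :=
  (existsUnique_coproduct h).choose

theorem inducedCoproduct_spec (h : IsQuadraticGradedPerm ℬ mul ϖ) (b e f : B) :
    ctPairing ℬ ϖ (inducedCoproduct h b) e f = - ϖ b (mul e f) :=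
  (existsUnique_coproduct h).choose_spec.1 b e f

end Coproduct

/-! ### Dendriform algebras, coalgebras and `D`-bialgebras -/

section Dendriform

variable {k : Type u} [Field k] {D : Type w} [AddCommGroup D] [Module k D]

/-- A dendriform algebra `(D, ≺, ≻)`. -/
structure IsDendriform (prec succ : D →ₗ[k] D →ₗ[k] D) : Prop where
  prec_prec : ∀ x y z, prec (prec x y) z = prec x (prec y z) + prec x (succ y z)
  succ_prec : ∀ x y z, prec (succ x y) z = succ x (prec y z)
  succ_succ : ∀ x y z, succ x (succ y z) = succ (prec x y) z + succ (succ x y) z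

/-- `(θ ⊗ id) t`, rebracketed as an element of `D ⊗ (D ⊗ D)`. -/
def tensorLeft (θ : D →ₗ[k] D ⊗[k] D) : D ⊗[k] D →ₗ[k] D ⊗[k] (D ⊗[k] D) :=
  (TensorProduct.assoc k D D D).toLinearMap ∘ₗ TensorProduct.map θ LinearMap.id

/-- `(id ⊗ θ) t`. -/
def tensorRight (θ : D →ₗ[k] D ⊗[k] D) : D ⊗[k] D →ₗ[k] D ⊗[k] (D ⊗[k] D) :=
  TensorProduct.map LinearMap.id θ

/-- A dendriform coalgebra `(D, θ_≺, θ_≻)`. -/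
structure IsDendriformCoalgebra (θprec θsucc : D →ₗ[k] D ⊗[k] D) : Prop where
  prec_prec : ∀ d, tensorLeft θprec (θprec d) =
    tensorRight θprec (θprec d) + tensorRight θsucc (θprec d)
  succ_prec : ∀ d, tensorLeft θsucc (θprec d) = tensorRight θprec (θsucc d)
  succ_succ : ∀ d, tensorRight θsucc (θsucc d) =
    tensorLeft θprec (θsucc d) + tensorLeft θsucc (θsucc d)

/-- `(f ⊗ id) t`. -/
abbrev onLeft (f : D →ₗ[k] D) : D ⊗[k] D →ₗ[k] D ⊗[k] D := TensorProduct.map f LinearMap.id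

/-- `(id ⊗ f) t`. -/
abbrev onRight (f : D →ₗ[k] D) : D ⊗[k] D →ₗ[k] D ⊗[k] D := TensorProduct.map LinearMap.id f

/-- A dendriform `D`-bialgebra `(D, ≺, ≻, θ_≺, θ_≻)`. Left and right multiplications are
`l_≺(x) = prec x`, `r_≺(x) = prec.flip x`, and similarly for `≻`. -/
structure IsDendriformDBialgebra (prec succ : D →ₗ[k] D →ₗ[k] D)
    (θprec θsucc : D →ₗ[k] D ⊗[k] D) : Prop where
  alg : IsDendriform prec succ
  coalg : IsDendriformCoalgebra θprec θsucc
  compat₁ : ∀ x y, θprec (prec x y + succ x y) =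
    onRight (succ x) (θprec y) + onLeft ((prec + succ).flip y) (θprec x)
  compat₂ : ∀ x y, θsucc (prec x y + succ x y) =
    onRight ((prec + succ) x) (θsucc y) + onLeft (prec.flip y) (θsucc x)
  compat₃ : ∀ x y, θprec (prec x y) + θsucc (prec x y) =
    onRight (prec x) (θsucc y) + onLeft (prec.flip y) ((θprec + θsucc) x)
  compat₄ : ∀ x y, θprec (succ x y) + θsucc (succ x y) =
    onRight (succ x) ((θprec + θsucc) y) + onLeft (succ.flip y) (θprec x)
  compat₅ : ∀ x y,
    onLeft ((prec + succ) x) (θprec y) - onRight (prec.flip x) (θprec y) =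
      - TensorProduct.comm k D D
          (onLeft (succ y) (θsucc x) - onRight ((prec + succ).flip y) (θsucc x))
  compat₆ : ∀ x y,
    onLeft (succ y) ((θprec + θsucc) x) - onRight (prec.flip y) ((θprec + θsucc) x) =
      TensorProduct.comm k D D
        (onRight (succ.flip x) (θsucc y) - onLeft (prec x) (θprec y))

end Dendriform

/-! ### The affinization `D ⊗ B` -/

section Affinization

variable {k : Type u} [Field k] {Γ : Type v}
  {D : Type w} [AddCommGroup D] [Module k D] {B : Type*} [AddCommGroup B] [Module k B]

/-- The grading of `D ⊗ B`: its component of degree `i` is `D ⊗ B_i`. -/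
def affGrading (D : Type w) [AddCommGroup D] [Module k D] (ℬ : Γ → Submodule k B) (i : Γ) :
    Submodule k (D ⊗[k] B) :=
  LinearMap.range (TensorProduct.map (LinearMap.id : D →ₗ[k] D) (ℬ i).subtype)

/-- The product `(d₁ ⊗ b₁) * (d₂ ⊗ b₂) = (d₁ ≻ d₂) ⊗ b₁ b₂ + (d₁ ≺ d₂) ⊗ b₂ b₁` on `D ⊗ B`. -/
def affMul (prec succ : D →ₗ[k] D →ₗ[k] D) (mul : B →ₗ[k] B →ₗ[k] B) :
    D ⊗[k] B →ₗ[k] D ⊗[k] B →ₗ[k] D ⊗[k] B :=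
  TensorProduct.map₂ succ mul + TensorProduct.map₂ prec mul.flip

theorem affMul_tmul (prec succ : D →ₗ[k] D →ₗ[k] D) (mul : B →ₗ[k] B →ₗ[k] B)
    (d₁ d₂ : D) (b₁ b₂ : B) :
    affMul prec succ mul (d₁ ⊗ₜ b₁) (d₂ ⊗ₜ b₂) =
      succ d₁ d₂ ⊗ₜ mul b₁ b₂ + prec d₁ d₂ ⊗ₜ mul b₂ b₁ := rfl

/-- The operation `t • X` of `D ⊗ D` and `B ⊗̂ B` with values in `(D ⊗ B) ⊗̂ (D ⊗ B)`:
`(d₁ ⊗ d₂) • Σ x_i ⊗ y_j = Σ (d₁ ⊗ x_i) ⊗ (d₂ ⊗ y_j)`. -/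
def bullet (ℬ : Γ → Submodule k B) (t : D ⊗[k] D) (X : CTensor ℬ ℬ) :
    CTensor (affGrading D ℬ) (affGrading D ℬ) := fun i j =>
  TensorProduct.map
    (LinearMap.rangeRestrict (TensorProduct.map (LinearMap.id : D →ₗ[k] D) (ℬ i).subtype))
    (LinearMap.rangeRestrict (TensorProduct.map (LinearMap.id : D →ₗ[k] D) (ℬ j).subtype))
    (TensorProduct.tensorTensorTensorComm k D D (ℬ i) (ℬ j) (t ⊗ₜ X i j))

/-- The coproduct `Δ(d ⊗ b) = θ_≻(d) • ν(b) + θ_≺(d) • τ̂(ν(b))` on `D ⊗ B`. -/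
def affCoproduct (ℬ : Γ → Submodule k B) (θprec θsucc : D →ₗ[k] D ⊗[k] D)
    (ν : B →ₗ[k] CTensor ℬ ℬ) :
    D ⊗[k] B →ₗ[k] CTensor (affGrading D ℬ) (affGrading D ℬ) :=
  TensorProduct.lift <| LinearMap.mk₂ k
    (fun d b => bullet ℬ (θsucc d) (ν b) + bullet ℬ (θprec d) (ctTwist ℬ (ν b)))
    (fun d d' b => by
      funext i j; simp [bullet, TensorProduct.add_tmul]; abel)
    (fun r d b => by
      funext i j; simp [bullet, ← TensorProduct.smul_tmul']; exact (smul_add _ _ _).symm)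
    (fun d b b' => by
      funext i j; simp [bullet, ctTwist, TensorProduct.tmul_add]; abel)
    (fun r d b => by
      funext i j; simp [bullet, ctTwist]; exact (smul_add _ _ _).symm)

theorem affCoproduct_tmul (ℬ : Γ → Submodule k B) (θprec θsucc : D →ₗ[k] D ⊗[k] D)
    (ν : B →ₗ[k] CTensor ℬ ℬ) (d : D) (b : B) :
    affCoproduct ℬ θprec θsucc ν (d ⊗ₜ b) =
      bullet ℬ (θsucc d) (ν b) + bullet ℬ (θprec d) (ctTwist ℬ (ν b)) := by
  simp [affCoproduct]

end Affinization

/-! ### The Laurent-polynomial quadratic perm algebra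

`B = {f₁ ∂₁ + f₂ ∂₂ | f₁, f₂ ∈ k[x₁^±, x₂^±]}`. The ring `k[x₁^±, x₂^±]` is the
monoid algebra of `ℤ × ℤ`, and `f₁ ∂₁ + f₂ ∂₂` is the function with values `f₁, f₂`. -/

section Laurent

variable (k : Type u) [Field k]

/-- `f₁ ∂₁ + f₂ ∂₂` with Laurent polynomials `f₁, f₂` in two variables. -/
abbrev LaurentVF : Type u := Fin 2 → AddMonoidAlgebra k (ℤ × ℤ)

/-- The exponents of the variables `x₁` and `x₂`. -/
def expo : Fin 2 → ℤ × ℤ := ![(1, 0), (0, 1)]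

/-- The monomial `x₁^{p.1} x₂^{p.2} ∂_s`. -/
def laurentMonomial (p : ℤ × ℤ) (s : Fin 2) : LaurentVF k :=
  Pi.single s (AddMonoidAlgebra.single p 1)

/-- `f₁ ∂₁ + f₂ ∂₂ ↦ x₁ f₁ + x₂ f₂`. -/
def laurentContract : LaurentVF k →ₗ[k] AddMonoidAlgebra k (ℤ × ℤ) where
  toFun f := AddMonoidAlgebra.single (expo 0) 1 * f 0 + AddMonoidAlgebra.single (expo 1) 1 * f 1
  map_add' f g := by simp only [Pi.add_apply]; ring
  map_smul' r f := by simp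

/-- The product on `B`, given on monomials by
`(x^p ∂_s) · (x^q ∂_t) = x_s x^{p+q} ∂_t`; see `laurentMul_monomial`. -/
def laurentMul : LaurentVF k →ₗ[k] LaurentVF k →ₗ[k] LaurentVF k :=
  LinearMap.mk₂ k (fun f g => laurentContract k f • g)
    (fun f f' g => by simp [add_smul]) (fun r f g => by simp)
    (fun f g g' => by simp [smul_add]) (fun r f g => by rw [smul_comm])

theorem laurentMul_monomial (p q : ℤ × ℤ) (s t : Fin 2) :
    laurentMul k (laurentMonomial k p s) (laurentMonomial k q t) =
      laurentMonomial k (p + q + expo s) t := by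
  funext r
  fin_cases s <;> fin_cases t <;> fin_cases r <;>
    simp [laurentMul, laurentMonomial, laurentContract, AddMonoidAlgebra.single_mul_single,
      add_right_comm, add_assoc, add_comm (expo _)]

/-- The form on `B`, given by the coefficient of `x₁^0 x₂^0` in `f₂ g₁ - f₁ g₂`; on monomials
see `laurentForm_monomial`. -/
def laurentForm : LaurentVF k →ₗ[k] LaurentVF k →ₗ[k] k :=
  LinearMap.mk₂ k (fun f g => (f 1 * g 0 - f 0 * g 1).coeff 0)
    (fun f f' g => by simp [add_mul]; ring) (fun r f g => by simp [mul_sub])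
    (fun f g g' => by simp [mul_add]; ring) (fun r f g => by simp [mul_sub])

theorem laurentForm_monomial (p q : ℤ × ℤ) :
    laurentForm k (laurentMonomial k p 1) (laurentMonomial k q 0) = (if p + q = 0 then 1 else 0) ∧
    laurentForm k (laurentMonomial k q 0) (laurentMonomial k p 1) =
      - (if p + q = 0 then 1 else 0) ∧
    laurentForm k (laurentMonomial k p 0) (laurentMonomial k q 0) = 0 ∧
    laurentForm k (laurentMonomial k p 1) (laurentMonomial k q 1) = 0 := by
  refine ⟨?_, ?_, ?_, ?_⟩ <;>
    simp [laurentForm, laurentMonomial, AddMonoidAlgebra.single_mul_single, Finsupp.single_apply,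
      add_comm]

/-- The grading of `B` by `ℤ × ℤ` in which `x^p ∂_s` has degree `p + (1,0)` for `s = 1` and
`p + (0,1)` for `s = 2`. It refines the grading by the total degree in which the component of
degree `n` is spanned by the monomials of total degree `n - 1` times `∂₁`, `∂₂`. -/
def laurentGrading (γ : ℤ × ℤ) : Submodule k (LaurentVF k) where
  carrier := {f | ∀ s p, p + expo s ≠ γ → (f s).coeff p = 0}
  add_mem' := fun {f g} hf hg s p hp => by simp [hf s p hp, hg s p hp]
  zero_mem' := fun s p _ => by simp
  smul_mem' := fun r f hf s p hp => by simp [hf s p hp]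

theorem laurentMonomial_mem (p : ℤ × ℤ) (s : Fin 2) :
    laurentMonomial k p s ∈ laurentGrading k (p + expo s) := by
  intro t q hq
  by_cases h : t = s
  · subst h
    have : p ≠ q := fun h => hq (by rw [h])
    simp [laurentMonomial, this]
  · simp [laurentMonomial, h]

theorem laurent_span :
    Submodule.span k (Set.range fun x : (ℤ × ℤ) × Fin 2 => laurentMonomial k x.1 x.2) = ⊤ := by
  rw [eq_top_iff]
  intro f _
  have key : ∀ (s : Fin 2) (a : AddMonoidAlgebra k (ℤ × ℤ)), (Pi.single s a : LaurentVF k) ∈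
      Submodule.span k (Set.range fun x : (ℤ × ℤ) × Fin 2 => laurentMonomial k x.1 x.2) := by
    intro s a
    induction a using AddMonoidAlgebra.induction_linear with
    | zero => simp
    | add a b ha hb => rw [Pi.single_add]; exact Submodule.add_mem _ ha hb
    | single p c =>
      have : (Pi.single s (AddMonoidAlgebra.single p c) : LaurentVF k) =
          c • laurentMonomial k p s := by
        rw [laurentMonomial, ← Pi.single_smul]; simp
      rw [this]
      exact Submodule.smul_mem _ _ (Submodule.subset_span ⟨(p, s), rfl⟩)
  rw [← Finset.univ_sum_single f]
  exact Submodule.sum_mem _ fun s _ => key s _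

theorem laurent_coeff (x : ⨁ γ, laurentGrading k γ) (γ : ℤ × ℤ) (s : Fin 2) (p : ℤ × ℤ) :
    ((x γ : LaurentVF k) s).coeff p =
      if p + expo s = γ then ((DirectSum.coeLinearMap (laurentGrading k) x) s).coeff p else 0 := by
  induction x using DirectSum.induction_on with
  | zero => simp
  | of i y =>
    rw [DirectSum.coeLinearMap_of]
    by_cases h : i = γ
    · subst h
      rw [DirectSum.of_eq_same]
      split_ifs with hp
      · rfl
      · exact y.2 s p hp
    · rw [DirectSum.of_eq_of_ne _ _ _ (Ne.symm h)]
      split_ifs with hp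
      · rw [y.2 s p (by rw [hp]; exact Ne.symm h)]; simp
      · simp
  | add x y hx hy =>
    rw [DirectSum.add_apply, Submodule.coe_add, Pi.add_apply, AddMonoidAlgebra.coeff_add,
      Finsupp.add_apply, hx, hy, map_add]
    split_ifs <;> simp

theorem laurent_internal : DirectSum.IsInternal (laurentGrading k) := by
  constructor
  · intro x y hxy
    refine DFinsupp.ext fun γ => Subtype.ext (funext fun s => ?_)
    refine AddMonoidAlgebra.ext (Finsupp.ext fun p => ?_)
    have h1 := laurent_coeff k x γ s p
    have h2 := laurent_coeff k y γ s p
    have h3 : DirectSum.coeLinearMap (laurentGrading k) x =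
      DirectSum.coeLinearMap (laurentGrading k) y := hxy
    rw [h3] at h1
    exact h1.trans h2.symm
  · have : LinearMap.range (DirectSum.coeLinearMap (laurentGrading k)) = ⊤ := by
      rw [eq_top_iff, ← laurent_span, Submodule.span_le]
      rintro _ ⟨⟨p, s⟩, rfl⟩
      exact ⟨DirectSum.of _ _ ⟨_, laurentMonomial_mem k p s⟩, DirectSum.coeLinearMap_of _ _ _⟩
    exact LinearMap.range_eq_top.1 this

theorem laurent_finite (γ : ℤ × ℤ) : FiniteDimensional k (laurentGrading k γ) := by
  let φ : laurentGrading k γ →ₗ[k] (Fin 2 → k) :=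
    { toFun := fun f s => ((f : LaurentVF k) s).coeff (γ - expo s)
      map_add' := fun f g => by funext s; simp
      map_smul' := fun r f => by funext s; simp }
  refine FiniteDimensional.of_injective φ ?_
  intro f g hfg
  refine Subtype.ext (funext fun s => AddMonoidAlgebra.ext (Finsupp.ext fun p => ?_))
  by_cases hp : p + expo s = γ
  · have : p = γ - expo s := eq_sub_of_add_eq hp
    rw [this]
    exact congrFun hfg s
  · rw [f.2 s p hp, g.2 s p hp]

theorem laurent_mem_span (γ : ℤ × ℤ) (f : LaurentVF k) (hf : f ∈ laurentGrading k γ) :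
    f ∈ Submodule.span k (Set.range fun s => laurentMonomial k (γ - expo s) s) := by
  have : f = ∑ s, (f s).coeff (γ - expo s) • laurentMonomial k (γ - expo s) s := by
    rw [← Finset.univ_sum_single f]
    refine Finset.sum_congr rfl fun s _ => ?_
    rw [Finset.univ_sum_single f, laurentMonomial, ← Pi.single_smul]
    congr 1
    refine AddMonoidAlgebra.ext (Finsupp.ext fun p => ?_)
    by_cases hp : p + expo s = γ
    · have : p = γ - expo s := eq_sub_of_add_eq hp
      simp [this]
    · have h' : γ - expo s ≠ p := fun h => hp (by rw [← h]; abel)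
      rw [hf s p hp]
      simp [h']
  rw [this]
  exact Submodule.sum_mem _ fun s _ => Submodule.smul_mem _ _ (Submodule.subset_span ⟨s, rfl⟩)

/-- The Laurent-polynomial example is a quadratic graded perm algebra. -/
theorem laurent_isQuadratic :
    IsQuadraticGradedPerm (laurentGrading k) (laurentMul k) (laurentForm k) where
  internal := laurent_internal k
  finite := laurent_finite k
  mul_mem i j a ha b hb := by
    have ha' := laurent_mem_span k i a ha
    have hb' := laurent_mem_span k j b hb
    clear ha hb
    induction ha' using Submodule.span_induction with
    | mem a ha =>
      obtain ⟨s, rfl⟩ := ha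
      induction hb' using Submodule.span_induction with
      | mem b hb =>
        obtain ⟨t, rfl⟩ := hb
        dsimp only
        rw [laurentMul_monomial]
        convert laurentMonomial_mem k _ t using 2
        abel
      | zero => simp
      | add x y _ _ hx hy => rw [map_add]; exact Submodule.add_mem _ hx hy
      | smul r x _ hx => rw [map_smul]; exact Submodule.smul_mem _ _ hx
    | zero => simp
    | add x y _ _ hx hy => rw [map_add]; exact Submodule.add_mem _ hx hy
    | smul r x _ hx => rw [map_smul]; exact Submodule.smul_mem _ _ hx
  assoc a b c := by
    funext s; simp [laurentMul, laurentContract]; ring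
  perm a b c := by
    funext s; simp only [laurentMul, laurentContract, LinearMap.mk₂_apply, LinearMap.coe_mk,
      AddHom.coe_mk, Pi.smul_apply, smul_eq_mul]
    ring
  antisymm a b := by
    simp only [laurentForm, LinearMap.mk₂_apply]
    rw [← Finsupp.neg_apply, ← AddMonoidAlgebra.coeff_neg]
    congr 2; ring
  invariant a b c := by
    simp only [laurentForm, laurentMul, LinearMap.mk₂_apply]
    congr 2
    simp [laurentContract]; ring
  nondegenerate := by
    have hl : ∀ f : LaurentVF k, (∀ g, laurentForm k f g = 0) → f = 0 := by
      intro f hf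
      have h1 : f 1 = 0 := by
        refine AddMonoidAlgebra.ext (Finsupp.ext fun p => ?_)
        simpa [laurentForm, laurentMonomial] using hf (laurentMonomial k (-p) 0)
      have h0 : f 0 = 0 := by
        refine AddMonoidAlgebra.ext (Finsupp.ext fun p => ?_)
        simpa [laurentForm, laurentMonomial] using hf (laurentMonomial k (-p) 1)
      funext s
      fin_cases s
      · exact h0
      · exact h1
    refine ⟨hl, fun g hg => hl g fun f => ?_⟩
    have := hg f
    simp only [laurentForm, LinearMap.mk₂_apply] at this ⊢
    rw [← neg_eq_zero, ← Finsupp.neg_apply, ← AddMonoidAlgebra.coeff_neg, ← this]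
    congr 2; ring
  graded := by
    refine ⟨(-1, -1), fun i j hij a ha b hb => ?_⟩
    have ha' := laurent_mem_span k i a ha
    have hb' := laurent_mem_span k j b hb
    clear ha hb
    induction ha' using Submodule.span_induction with
    | mem a ha =>
      obtain ⟨s, rfl⟩ := ha
      induction hb' using Submodule.span_induction with
      | mem b hb =>
        obtain ⟨t, rfl⟩ := hb
        dsimp only
        have e : expo 0 + expo 1 = (1, 1) := by simp [expo]
        fin_cases s <;> fin_cases t
        · exact (laurentForm_monomial k _ _).2.2.1
        · refine (laurentForm_monomial k _ _).2.1.trans ?_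
          rw [if_neg, neg_zero]
          intro h
          apply hij
          have h2 : i + j = expo 0 + expo 1 := by
            rw [← sub_eq_zero, ← h]; simp; abel
          rw [h2, e]; rfl
        · refine (laurentForm_monomial k _ _).1.trans ?_
          rw [if_neg]
          intro h
          apply hij
          have h2 : i + j = expo 0 + expo 1 := by
            rw [← sub_eq_zero, ← h]; simp; abel
          rw [h2, e]; rfl
        · exact (laurentForm_monomial k _ _).2.2.2
      | zero => simp
      | add x y _ _ hx hy => rw [map_add, hx, hy, add_zero]
      | smul r x _ hx => rw [map_smul, hx, smul_zero]
    | zero => simp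
    | add x y _ _ hx hy => rw [map_add, LinearMap.add_apply, hx, hy, add_zero]
    | smul r x _ hx => rw [map_smul, LinearMap.smul_apply, hx, smul_zero]

end Laurent

end DendriformASI

end

/-!
Contracting the two legs of a completed tensor in `(D ⊗ B) ⊗̂ (D ⊗ B)` with elements `e`, `f` of `B`,
by means of the form `ϖ`, gives an element of `D ⊗ D`. As the form is nondegenerate, a completed
tensor is determined by its contractions with homogeneous `e`, `f` (`Represents.eq_iff`), and
likewise for three legs. So the axioms of a completed ASI bialgebra may be checked after
contraction, where no infinite sums are left.

After contraction everything is explicit. The coproduct `Δ(d ⊗ b)` becomes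
`-ϖ(b, e f) θ_≻(d) - ϖ(b, f e) θ_≺(d)`, and by invariance of the form, multiplications of `D ⊗ B`
acting on a leg become multiplications of `D`, combined with the adjoint of a multiplication of `B`
acting on `e` or `f`: the adjoint of left multiplication by `b` is itself, that of right
multiplication is `e ↦ b e - e b`. All scalars that occur have the form `ϖ(b, (u v) w)`, where
`{u, v, w} = {c, e, f}`. In a perm algebra `(u v) w = (v u) w`, so there are only three of them, one
for each choice of the last factor. Collecting their coefficients, each axiom of an ASI bialgebra on
pure tensors becomes the vanishing of a combination of three elements, which are the defects of
axioms of a dendriform `D`-bialgebra (`affMul_associator`, `coassoc_iff`, `comul_mul_iff`,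
`antisymm_iff`). This gives the direct implication.

For the converse it is enough to find `b`, `u`, `w` in `B` with `ϖ(b, (u u) w) = 1` and
`ϖ(b, (u w) u) = 0`: putting `w` in one of the three slots and `u` in the other two makes one of the
three scalars equal to one and the others zero. In the Laurent-polynomial algebra this
holds for `u = ∂₂`, `w = ∂₁`, `b = x₂⁻² ∂₂`.
-/

noncomputable section

namespace DendriformASI

/-! ### Jointly injective families of linear maps -/

section JointlyInjective

variable {k : Type*} [Field k] {U V P Q : Type*} [AddCommGroup U] [Module k U]
  [AddCommGroup V] [Module k V] [AddCommGroup P] [Module k P] [AddCommGroup Q] [Module k Q]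

/-- A family of linear maps out of `U` that separates the points of `U`. -/
def JointlyInjective {ι : Type*} (σ : ι → U →ₗ[k] P) : Prop :=
  ∀ u, (∀ i, σ i u = 0) → u = 0

theorem JointlyInjective.eq {ι : Type*} {σ : ι → U →ₗ[k] P} (h : JointlyInjective σ) {u v : U}
    (huv : ∀ i, σ i u = σ i v) : u = v :=
  sub_eq_zero.1 (h _ fun i => by rw [map_sub, huv, sub_self])

theorem tensor_eq_zero_of_lTensor_dual (t : U ⊗[k] V)
    (h : ∀ ψ : Module.Dual k V, TensorProduct.map (LinearMap.id : U →ₗ[k] U) ψ t = 0) :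
    t = 0 := by
  classical
  let b := Module.Basis.ofVectorSpace k V
  refine (TensorProduct.equivFinsuppOfBasisRight b).injective (Finsupp.ext fun i => ?_)
  rw [TensorProduct.equivFinsuppOfBasisRight_apply, map_zero, Finsupp.zero_apply]
  exact (congrArg _ (h (b.coord i))).trans (map_zero _)

theorem JointlyInjective.map_id {ι : Type*} {σ : ι → U →ₗ[k] P} (h : JointlyInjective σ) :
    JointlyInjective fun i => TensorProduct.map (σ i) (LinearMap.id : V →ₗ[k] V) := by
  intro t ht
  refine tensor_eq_zero_of_lTensor_dual t fun ψ => ?_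
  refine (TensorProduct.rid k U).injective ?_
  rw [map_zero]
  refine h _ fun i => ?_
  have key : σ i ∘ₗ (TensorProduct.rid k U).toLinearMap ∘ₗ TensorProduct.map LinearMap.id ψ =
      (TensorProduct.rid k P).toLinearMap ∘ₗ TensorProduct.map LinearMap.id ψ ∘ₗ
        TensorProduct.map (σ i) LinearMap.id := by
    ext u v; simp
  have := LinearMap.congr_fun key t
  simp only [LinearMap.comp_apply, LinearEquiv.coe_coe] at this
  rw [this, ht i, map_zero, map_zero]

theorem JointlyInjective.id_map {κ : Type*} {τ : κ → V →ₗ[k] Q} (h : JointlyInjective τ) :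
    JointlyInjective fun j => TensorProduct.map (LinearMap.id : U →ₗ[k] U) (τ j) := by
  intro t ht
  refine (TensorProduct.comm k U V).injective ?_
  rw [map_zero]
  refine (h.map_id (V := U)) _ fun j => ?_
  rw [TensorProduct.map_comm]
  exact (congrArg _ (ht j)).trans (map_zero _)

/-- Over a field, tensor products of jointly injective families are jointly injective. -/
theorem JointlyInjective.map {ι κ : Type*} {σ : ι → U →ₗ[k] P} {τ : κ → V →ₗ[k] Q}
    (hσ : JointlyInjective σ) (hτ : JointlyInjective τ) :
    JointlyInjective fun p : ι × κ => TensorProduct.map (σ p.1) (τ p.2) := by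
  intro t ht
  refine hσ.map_id t fun i => hτ.id_map _ fun j => ?_
  have := ht (i, j)
  rwa [← LinearMap.comp_apply, ← TensorProduct.map_comp, LinearMap.id_comp, LinearMap.comp_id]

end JointlyInjective

/-! ### Graded projections and the grading of `D ⊗ B` -/

section Grading

variable {k : Type*} [Field k] {Γ : Type*} {A : Type*} [AddCommGroup A]
  [Module k A] {𝒜 : Γ → Submodule k A}

theorem gproj_of_mem [DecidableEq Γ] (h : DirectSum.IsInternal 𝒜) {i : Γ} {a : A} (ha : a ∈ 𝒜 i) :
    gproj 𝒜 i a = ⟨a, ha⟩ := by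
  have : (LinearEquiv.ofBijective (DirectSum.coeLinearMap 𝒜) h).symm a =
      DirectSum.lof k Γ (fun i => 𝒜 i) i ⟨a, ha⟩ := by
    rw [LinearEquiv.symm_apply_eq]
    exact (DirectSum.coeLinearMap_lof 𝒜 _ ⟨a, ha⟩).symm
  simp [gproj, h, this]

theorem gproj_of_mem_of_ne [DecidableEq Γ] (h : DirectSum.IsInternal 𝒜) {i j : Γ}
    (hij : i ≠ j) {a : A} (ha : a ∈ 𝒜 j) : gproj 𝒜 i a = 0 := by
  have : (LinearEquiv.ofBijective (DirectSum.coeLinearMap 𝒜) h).symm a =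
      DirectSum.lof k Γ (fun i => 𝒜 i) j ⟨a, ha⟩ := by
    rw [LinearEquiv.symm_apply_eq]
    exact (DirectSum.coeLinearMap_lof 𝒜 _ ⟨a, ha⟩).symm
  simp [gproj, h, this, DirectSum.component.of, hij.symm]

variable {D : Type*} [AddCommGroup D] [Module k D] {B : Type*} [AddCommGroup B] [Module k B]
  {ℬ : Γ → Submodule k B}

theorem tmul_mem_affGrading (d : D) {i : Γ} {b : B} (hb : b ∈ ℬ i) :
    d ⊗ₜ[k] b ∈ affGrading D ℬ i :=
  ⟨d ⊗ₜ ⟨b, hb⟩, by simp⟩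

theorem affGrading_induction {i : Γ} {p : D ⊗[k] B → Prop} (zero : p 0)
    (tmul : ∀ d, ∀ b ∈ ℬ i, p (d ⊗ₜ b)) (add : ∀ x y, p x → p y → p (x + y))
    {a : D ⊗[k] B} (ha : a ∈ affGrading D ℬ i) : p a := by
  obtain ⟨t, rfl⟩ := ha
  induction t using TensorProduct.induction_on with
  | zero => rwa [map_zero]
  | tmul d b => exact tmul d b b.2
  | add x y hx hy => rw [map_add]; exact add _ _ hx hy

/-- Every element of `D ⊗ B` is a sum of pure tensors with homogeneous second factor. -/
theorem homogeneous_tmul_induction [DecidableEq Γ] (h : DirectSum.IsInternal ℬ)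
    {p : D ⊗[k] B → Prop} (zero : p 0) (tmul : ∀ d i, ∀ b ∈ ℬ i, p (d ⊗ₜ b))
    (add : ∀ x y, p x → p y → p (x + y))
    (a : D ⊗[k] B) : p a := by
  induction a using TensorProduct.induction_on with
  | zero => exact zero
  | tmul d b =>
    have hb : b ∈ iSup ℬ := by rw [h.submodule_iSup_eq_top]; trivial
    induction hb using Submodule.iSup_induction' with
    | mem i b hb => exact tmul d i b hb
    | zero => rwa [TensorProduct.tmul_zero]
    | add b c _ _ hb hc => rw [TensorProduct.tmul_add]; exact add _ _ hb hc
  | add x y hx hy => exact add _ _ hx hy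

theorem affGrading_isInternal [DecidableEq Γ] (h : DirectSum.IsInternal ℬ) :
    DirectSum.IsInternal (affGrading D ℬ) := by
  refine DirectSum.isInternal_submodule_of_iSupIndep_of_iSup_eq_top ?_ ?_
  · intro i
    -- the projection onto `D ⊗ B_i` is the identity on `D ⊗ B_i` and vanishes on `D ⊗ B_j`
    let π : D ⊗[k] B →ₗ[k] D ⊗[k] B :=
      TensorProduct.map LinearMap.id ((ℬ i).subtype ∘ₗ gproj ℬ i)
    have h1 : ∀ a ∈ affGrading D ℬ i, π a = a := fun a ha => by
      refine affGrading_induction (p := fun a => π a = a) (map_zero _)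
        (fun d b hb => ?_) (fun x y hx hy => ?_) ha
      · simp [π, gproj_of_mem h hb]
      · rw [map_add, hx, hy]
    have h2 : ⨆ j, ⨆ _ : j ≠ i, affGrading D ℬ j ≤ LinearMap.ker π := by
      refine iSup₂_le fun j hj a ha => ?_
      rw [LinearMap.mem_ker]
      refine affGrading_induction (p := fun a => π a = 0) (map_zero _)
        (fun d b hb => ?_) (fun x y hx hy => ?_) ha
      · simp [π, gproj_of_mem_of_ne h hj.symm hb]
      · rw [map_add, hx, hy, add_zero]
    rw [Submodule.disjoint_def]
    intro a ha ha'
    rw [← h1 a ha]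
    exact h2 ha'
  · rw [eq_top_iff]
    intro a _
    refine homogeneous_tmul_induction h (zero_mem _) (fun d i b hb => ?_)
      (fun x y hx hy => add_mem hx hy) a
    exact Submodule.mem_iSup_of_mem i (tmul_mem_affGrading d hb)

end Grading

/-! ### Adjoints of multiplications and slices -/

section Slice

variable {k : Type*} [Field k] {Γ : Type*} [AddCommGroup Γ]
  {D : Type*} [AddCommGroup D] [Module k D] {B : Type*} [AddCommGroup B] [Module k B]
  {ℬ : Γ → Submodule k B} {mul : B →ₗ[k] B →ₗ[k] B} {ϖ : B →ₗ[k] B →ₗ[k] k}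

variable (D ϖ) in
/-- The contraction `d ⊗ b ↦ ϖ(b, e) d` of the second factor of `D ⊗ B` with `e`. -/
def slice (e : B) : D ⊗[k] B →ₗ[k] D :=
  (TensorProduct.rid k D).toLinearMap ∘ₗ TensorProduct.map LinearMap.id (ϖ.flip e)

@[simp]
theorem slice_tmul (e : B) (d : D) (b : B) : slice D ϖ e (d ⊗ₜ b) = ϖ b e • d := by
  simp [slice]

theorem slice_add (e e' : B) : slice D ϖ (e + e') = slice D ϖ e + slice D ϖ e' := by
  ext d b; simp [add_smul]

theorem slice_eq_zero_of_mem {m : Γ}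
    (hm : ∀ i j, i + j + m ≠ 0 → ∀ a ∈ ℬ i, ∀ b ∈ ℬ j, ϖ a b = 0) {i j : Γ} (hij : i + j + m ≠ 0)
    {a : D ⊗[k] B} (ha : a ∈ affGrading D ℬ i) {e : B} (he : e ∈ ℬ j) : slice D ϖ e a = 0 := by
  refine affGrading_induction (p := fun a => slice D ϖ e a = 0) (map_zero _)
    (fun d b hb => ?_) (fun x y hx hy => ?_) ha
  · rw [slice_tmul, hm i j hij b hb e he, zero_smul]
  · rw [map_add, hx, hy, add_zero]

variable [DecidableEq Γ]

/-- Left multiplications of a quadratic perm algebra are self-adjoint. -/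
theorem form_mul_left (h : IsQuadraticGradedPerm ℬ mul ϖ) (b x e : B) :
    ϖ (mul b x) e = ϖ x (mul b e) := by
  rw [h.invariant b x e, h.antisymm x, h.invariant b e x, map_sub, map_sub]
  ring

theorem slice_jointlyInjective (h : IsQuadraticGradedPerm ℬ mul ϖ) :
    JointlyInjective (slice D ϖ) := by
  intro t ht
  have h1 : JointlyInjective (fun e => ϖ.flip e) := fun b hb => h.nondegenerate.1 b hb
  refine h1.id_map t fun e => ?_
  exact (TensorProduct.rid k D).map_eq_zero_iff.1 (ht e)

/-- On `D ⊗ B_i`, contractions with `B_{-m-i}` suffice to separate points. -/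
theorem slice_jointlyInjective_component (h : IsQuadraticGradedPerm ℬ mul ϖ) {m : Γ}
    (hm : ∀ i j, i + j + m ≠ 0 → ∀ a ∈ ℬ i, ∀ b ∈ ℬ j, ϖ a b = 0) (i : Γ) :
    JointlyInjective fun e : ℬ (-m - i) =>
      slice D ϖ (e : B) ∘ₗ (affGrading D ℬ i).subtype := by
  intro a ha
  refine Subtype.ext (slice_jointlyInjective h _ fun e => ?_)
  have he : e ∈ iSup ℬ := by rw [h.internal.submodule_iSup_eq_top]; trivial
  induction he using Submodule.iSup_induction' with
  | mem j e he =>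
    by_cases hij : i + j + m = 0
    · obtain rfl : j = -m - i := by rw [← add_right_inj i, ← add_left_inj m, hij]; abel
      exact ha ⟨e, he⟩
    · exact slice_eq_zero_of_mem hm hij a.2 he
  | zero => simp [slice]
  | add e e' _ _ he he' => rw [slice_add, LinearMap.add_apply, he, he', add_zero]

/-- The adjoint of a left multiplication of `D ⊗ B`, in the factor `B`. -/
theorem slice_comp_affMul (h : IsQuadraticGradedPerm ℬ mul ϖ) (prec succ : D →ₗ[k] D →ₗ[k] D)
    (x : D) (b e : B) :
    slice D ϖ e ∘ₗ affMul prec succ mul (x ⊗ₜ b) =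
      succ x ∘ₗ slice D ϖ (mul b e) + prec x ∘ₗ slice D ϖ (mul b e - mul e b) := by
  refine TensorProduct.ext' fun d c => ?_
  simp [affMul_tmul, form_mul_left h b, h.invariant c b e]

/-- The adjoint of a right multiplication of `D ⊗ B`, in the factor `B`. -/
theorem slice_comp_affMul_flip (h : IsQuadraticGradedPerm ℬ mul ϖ)
    (prec succ : D →ₗ[k] D →ₗ[k] D) (x : D) (b e : B) :
    slice D ϖ e ∘ₗ (affMul prec succ mul).flip (x ⊗ₜ b) =
      succ.flip x ∘ₗ slice D ϖ (mul b e - mul e b) + prec.flip x ∘ₗ slice D ϖ (mul b e) := by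
  refine TensorProduct.ext' fun d c => ?_
  simp [affMul_tmul, form_mul_left h b, h.invariant c b e]

theorem affMul_mem (h : IsGradedAlg ℬ mul) (prec succ : D →ₗ[k] D →ₗ[k] D) {i j : Γ}
    {a a' : D ⊗[k] B} (ha : a ∈ affGrading D ℬ i) (ha' : a' ∈ affGrading D ℬ j) :
    affMul prec succ mul a a' ∈ affGrading D ℬ (i + j) := by
  refine affGrading_induction (p := fun a => affMul prec succ mul a a' ∈ affGrading D ℬ (i + j))
    (by simp) (fun d b hb => ?_) (fun x y hx hy => ?_) ha
  · refine affGrading_induction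
      (p := fun a' => affMul prec succ mul (d ⊗ₜ b) a' ∈ affGrading D ℬ (i + j))
      (by simp) (fun d' b' hb' => ?_) (fun x y hx hy => ?_) ha'
    · rw [affMul_tmul]
      refine add_mem (tmul_mem_affGrading _ (h.mul_mem i j b hb b' hb')) ?_
      rw [add_comm i j]
      exact tmul_mem_affGrading _ (h.mul_mem j i b' hb' b hb)
    · rw [map_add]; exact add_mem hx hy
  · rw [map_add, LinearMap.add_apply]; exact add_mem hx hy

theorem affGrading_isGradedAlg [FiniteDimensional k D] (h : IsGradedAlg ℬ mul)
    (prec succ : D →ₗ[k] D →ₗ[k] D) :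
    IsGradedAlg (affGrading D ℬ) (affMul prec succ mul) where
  internal := affGrading_isInternal h.internal
  finite i := by
    have := h.finite i
    exact Module.Finite.range _
  mul_mem _ _ _ ha _ hb := affMul_mem h prec succ ha hb

end Slice

/-! ### Additivity of completed tensor products of maps -/

section Tame

variable {k : Type*} [Field k] {Γ : Type*} {A : Type*} [AddCommGroup A] [Module k A]
  {𝒜 : Γ → Submodule k A}

theorem ctTwist_add (X Y : CTensor 𝒜 𝒜) : ctTwist 𝒜 (X + Y) = ctTwist 𝒜 X + ctTwist 𝒜 Y := by
  funext i j
  exact map_add (TensorProduct.comm k (𝒜 j) (𝒜 i)) (X j i) (Y j i)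

theorem ctTwist_zero : ctTwist 𝒜 0 = 0 := by
  funext i j
  exact map_zero (TensorProduct.comm k (𝒜 j) (𝒜 i))

theorem ctensor_sub_self (X : CTensor 𝒜 𝒜) : X - X = 0 :=
  sub_self X

theorem ctensor_add_sub_add_comm (X Y Z W : CTensor 𝒜 𝒜) :
    X + Y - (Z + W) = X - Z + (Y - W) :=
  add_sub_add_comm X Y Z W

variable [DecidableEq Γ]

/-- A linear endomorphism of a graded space for which every homogeneous component of the target
receives contributions from only finitely many homogeneous components of the source. -/
def IsTame (𝒜 : Γ → Submodule k A) (f : A →ₗ[k] A) : Prop :=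
  ∀ i, {p | gproj 𝒜 i ∘ₗ f ∘ₗ (𝒜 p).subtype ≠ 0}.Finite

theorem IsTame.zero : IsTame 𝒜 (0 : A →ₗ[k] A) := fun i => by simp

theorem IsTame.add {f g : A →ₗ[k] A} (hf : IsTame 𝒜 f) (hg : IsTame 𝒜 g) :
    IsTame 𝒜 (f + g) := fun i => by
  refine ((hf i).union (hg i)).subset fun p hp => ?_
  by_contra hne
  simp only [Set.mem_union, Set.mem_ofPred_eq, not_or, not_not] at hne
  exact hp (by rw [LinearMap.add_comp, LinearMap.comp_add, hne.1, hne.2, add_zero])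

theorem gproj_comp_eq_zero_of_shift [AddCommGroup Γ] (h : DirectSum.IsInternal 𝒜)
    {f : A →ₗ[k] A} {s : Γ} (hf : ∀ p, ∀ a ∈ 𝒜 p, f a ∈ 𝒜 (p + s)) {i p : Γ} (hp : p + s ≠ i) :
    gproj 𝒜 i ∘ₗ f ∘ₗ (𝒜 p).subtype = 0 := by
  ext a
  simp [gproj_of_mem_of_ne h hp.symm (hf p a a.2)]

theorem IsTame.of_shift [AddCommGroup Γ] (h : DirectSum.IsInternal 𝒜) {f : A →ₗ[k] A} {s : Γ}
    (hf : ∀ p, ∀ a ∈ 𝒜 p, f a ∈ 𝒜 (p + s)) : IsTame 𝒜 f := fun i => by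
  refine (Set.finite_singleton (i - s)).subset fun p hp => ?_
  by_contra hne
  exact hp (gproj_comp_eq_zero_of_shift h hf fun h' => hne (eq_sub_of_add_eq h'))

theorem IsTame.id [AddCommGroup Γ] (h : DirectSum.IsInternal 𝒜) :
    IsTame 𝒜 (LinearMap.id : A →ₗ[k] A) :=
  IsTame.of_shift h (s := 0) fun p a ha => by rwa [add_zero]

theorem ctMap_hasFiniteSupport {f g : A →ₗ[k] A} (hf : IsTame 𝒜 f) (hg : IsTame 𝒜 g)
    (X : CTensor 𝒜 𝒜) (i j : Γ) :
    Function.HasFiniteSupport fun p : Γ × Γ => TensorProduct.map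
      (gproj 𝒜 i ∘ₗ f ∘ₗ (𝒜 p.1).subtype) (gproj 𝒜 j ∘ₗ g ∘ₗ (𝒜 p.2).subtype) (X p.1 p.2) := by
  refine ((hf i).prod (hg j)).subset fun p hp => ?_
  by_contra hne
  rw [Set.mem_prod, not_and_or] at hne
  simp only [Set.mem_ofPred_eq, not_not] at hne
  apply hp
  rcases hne with h | h <;> simp [h]

theorem ctMap_add {f g : A →ₗ[k] A} (hf : IsTame 𝒜 f) (hg : IsTame 𝒜 g) (X Y : CTensor 𝒜 𝒜) :
    ctMap 𝒜 f g (X + Y) = ctMap 𝒜 f g X + ctMap 𝒜 f g Y := by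
  funext i j
  refine Eq.trans (finsum_congr fun p => ?_) (finsum_add_distrib
    (ctMap_hasFiniteSupport hf hg X i j) (ctMap_hasFiniteSupport hf hg Y i j))
  exact map_add _ _ _

theorem ctMap_zero (f g : A →ₗ[k] A) : ctMap 𝒜 f g 0 = 0 := by
  funext i j
  refine (finsum_congr fun p => ?_).trans finsum_zero
  exact map_zero _

theorem ctMap_add_left {f f' g : A →ₗ[k] A} (hf : IsTame 𝒜 f) (hf' : IsTame 𝒜 f')
    (hg : IsTame 𝒜 g) (X : CTensor 𝒜 𝒜) :
    ctMap 𝒜 (f + f') g X = ctMap 𝒜 f g X + ctMap 𝒜 f' g X := by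
  funext i j
  refine Eq.trans (finsum_congr fun p => ?_) (finsum_add_distrib
    (ctMap_hasFiniteSupport hf hg X i j) (ctMap_hasFiniteSupport hf' hg X i j))
  rw [LinearMap.add_comp, LinearMap.comp_add, TensorProduct.map_add_left, LinearMap.add_apply]

theorem ctMap_add_right {f g g' : A →ₗ[k] A} (hf : IsTame 𝒜 f) (hg : IsTame 𝒜 g)
    (hg' : IsTame 𝒜 g') (X : CTensor 𝒜 𝒜) :
    ctMap 𝒜 f (g + g') X = ctMap 𝒜 f g X + ctMap 𝒜 f g' X := by
  funext i j
  refine Eq.trans (finsum_congr fun p => ?_) (finsum_add_distrib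
    (ctMap_hasFiniteSupport hf hg X i j) (ctMap_hasFiniteSupport hf hg' X i j))
  rw [LinearMap.add_comp, LinearMap.comp_add, TensorProduct.map_add_right, LinearMap.add_apply]

theorem ctMap_zero_left (g : A →ₗ[k] A) (X : CTensor 𝒜 𝒜) : ctMap 𝒜 0 g X = 0 := by
  funext i j
  exact (finsum_congr fun p => by simp).trans finsum_zero

theorem ctMap_zero_right (f : A →ₗ[k] A) (X : CTensor 𝒜 𝒜) : ctMap 𝒜 f 0 X = 0 := by
  funext i j
  exact (finsum_congr fun p => by simp).trans finsum_zero

/-- For homogeneous maps, a single component of `X` contributes to a component of `(f ⊗̂ g) X`. -/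
theorem ctMap_apply_of_shift [AddCommGroup Γ] (h : DirectSum.IsInternal 𝒜) {f g : A →ₗ[k] A}
    {s t : Γ} (hf : ∀ p, ∀ a ∈ 𝒜 p, f a ∈ 𝒜 (p + s)) (hg : ∀ p, ∀ a ∈ 𝒜 p, g a ∈ 𝒜 (p + t))
    (X : CTensor 𝒜 𝒜) (i j : Γ) :
    ctMap 𝒜 f g X (i + s) (j + t) = TensorProduct.map (gproj 𝒜 (i + s) ∘ₗ f ∘ₗ (𝒜 i).subtype)
      (gproj 𝒜 (j + t) ∘ₗ g ∘ₗ (𝒜 j).subtype) (X i j) := by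
  refine finsum_eq_single _ (i, j) fun p hp => ?_
  by_cases hi : p.1 + s = i + s
  · have hj : p.2 + t ≠ j + t := fun hj =>
      hp (Prod.ext (add_right_cancel hi) (add_right_cancel hj))
    rw [gproj_comp_eq_zero_of_shift h hg hj, TensorProduct.map_zero_right, LinearMap.zero_apply]
  · rw [gproj_comp_eq_zero_of_shift h hf hi, TensorProduct.map_zero_left, LinearMap.zero_apply]

theorem subtype_comp_gproj_of_shift [AddCommGroup Γ] (h : DirectSum.IsInternal 𝒜)
    {f : A →ₗ[k] A} {s : Γ} (hf : ∀ p, ∀ a ∈ 𝒜 p, f a ∈ 𝒜 (p + s)) (i : Γ) :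
    (𝒜 (i + s)).subtype ∘ₗ gproj 𝒜 (i + s) ∘ₗ f ∘ₗ (𝒜 i).subtype = f ∘ₗ (𝒜 i).subtype := by
  ext a
  simp [gproj_of_mem h (hf i a a.2)]

end Tame

/-! ### Completed tensors as functions of two homogeneous elements -/

section Represents

variable {k : Type*} [Field k] {Γ : Type*} [AddCommGroup Γ]
  {D : Type*} [AddCommGroup D] [Module k D] {B : Type*} [AddCommGroup B] [Module k B]
  {ℬ : Γ → Submodule k B} {ϖ : B →ₗ[k] B →ₗ[k] k} {m : Γ}

/-- The completed tensor `X` contracts with `e ⊗ f` to `F e f`, for all homogeneous `e` and `f`;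
`m` is the degree of the form. Only the component of `X` whose bidegree is complementary to that
of `e ⊗ f` enters. -/
def Represents (m : Γ) (ϖ : B →ₗ[k] B →ₗ[k] k) (X : CTensor (affGrading D ℬ) (affGrading D ℬ))
    (F : B → B → D ⊗[k] D) : Prop :=
  ∀ i j, ∀ e ∈ ℬ (-m - i), ∀ f ∈ ℬ (-m - j),
    TensorProduct.map (slice D ϖ e ∘ₗ (affGrading D ℬ i).subtype)
      (slice D ϖ f ∘ₗ (affGrading D ℬ j).subtype) (X i j) = F e f

variable {X Y : CTensor (affGrading D ℬ) (affGrading D ℬ)} {F G : B → B → D ⊗[k] D}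

theorem Represents.add (hX : Represents m ϖ X F) (hY : Represents m ϖ Y G) :
    Represents m ϖ (X + Y) fun e f => F e f + G e f := fun i j e he f hf => by
  beta_reduce
  rw [← hX i j e he f hf, ← hY i j e he f hf]
  exact map_add _ _ _

theorem Represents.sub (hX : Represents m ϖ X F) (hY : Represents m ϖ Y G) :
    Represents m ϖ (X - Y) fun e f => F e f - G e f := fun i j e he f hf => by
  beta_reduce
  rw [← hX i j e he f hf, ← hY i j e he f hf]
  exact map_sub (TensorProduct.map (slice D ϖ e ∘ₗ (affGrading D ℬ i).subtype)
    (slice D ϖ f ∘ₗ (affGrading D ℬ j).subtype)) (X i j) (Y i j)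

theorem Represents.twist (hX : Represents m ϖ X F) :
    Represents m ϖ (ctTwist _ X) fun e f => TensorProduct.comm k D D (F f e) :=
  fun i j e he f hf => by
    beta_reduce
    rw [← hX j i f hf e he]
    exact TensorProduct.map_comm _ _ _

variable [DecidableEq Γ] {mul : B →ₗ[k] B →ₗ[k] B}

/-- Completed tensors are determined by their contractions with homogeneous elements. -/
theorem Represents.eq_iff (h : IsQuadraticGradedPerm ℬ mul ϖ)
    (hm : ∀ i j, i + j + m ≠ 0 → ∀ a ∈ ℬ i, ∀ b ∈ ℬ j, ϖ a b = 0)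
    (hX : Represents m ϖ X F) (hY : Represents m ϖ Y G) :
    X = Y ↔ ∀ s t, ∀ e ∈ ℬ s, ∀ f ∈ ℬ t, F e f = G e f := by
  constructor
  · rintro rfl s t e he f hf
    have he' : e ∈ ℬ (-m - (-m - s)) := by rwa [sub_sub_cancel]
    have hf' : f ∈ ℬ (-m - (-m - t)) := by rwa [sub_sub_cancel]
    rw [← hX _ _ e he' f hf', hY _ _ e he' f hf']
  · intro hFG
    funext i j
    refine ((slice_jointlyInjective_component h hm i).map
      (slice_jointlyInjective_component h hm j)).eq fun p => ?_
    exact (hX i j _ p.1.2 _ p.2.2).trans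
      ((hFG _ _ _ p.1.2 _ p.2.2).trans (hY i j _ p.1.2 _ p.2.2).symm)

/-- A map of degree `s` acting on the left factor, described by an adjoint. -/
theorem Represents.ctMap_left (h : DirectSum.IsInternal ℬ) (hX : Represents m ϖ X F)
    {f : D ⊗[k] B →ₗ[k] D ⊗[k] B} {s : Γ}
    (hf : ∀ p, ∀ a ∈ affGrading D ℬ p, f a ∈ affGrading D ℬ (p + s))
    {φ ψ : D →ₗ[k] D} {α β : B → B}
    (hα : ∀ p, ∀ e ∈ ℬ p, α e ∈ ℬ (p + s)) (hβ : ∀ p, ∀ e ∈ ℬ p, β e ∈ ℬ (p + s))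
    (adj : ∀ e, slice D ϖ e ∘ₗ f = φ ∘ₗ slice D ϖ (α e) + ψ ∘ₗ slice D ϖ (β e)) :
    Represents m ϖ (ctMap _ f LinearMap.id X)
      fun e e' => onLeft φ (F (α e) e') + onLeft ψ (F (β e) e') := by
  intro i j e he e' he'
  beta_reduce
  have hA := affGrading_isInternal (D := D) h
  have hid : ∀ p, ∀ a ∈ affGrading D ℬ p, (LinearMap.id : _ →ₗ[k] D ⊗[k] B) a ∈
      affGrading D ℬ (p + 0) := fun p a ha => by rwa [add_zero]
  obtain ⟨i, rfl⟩ : ∃ i', i = i' + s := ⟨i - s, by abel⟩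
  obtain ⟨j, rfl⟩ : ∃ j', j = j' + 0 := ⟨j, by abel⟩
  have hs : -m - (i + s) + s = -m - i := by abel
  have h1 := hα _ e he
  have h2 := hβ _ e he
  rw [hs] at h1 h2
  rw [add_zero] at he'
  rw [ctMap_apply_of_shift hA hf hid, ← LinearMap.comp_apply, ← TensorProduct.map_comp,
    LinearMap.comp_assoc, LinearMap.comp_assoc, subtype_comp_gproj_of_shift hA hf,
    subtype_comp_gproj_of_shift hA hid, LinearMap.id_comp, ← LinearMap.comp_assoc, adj,
    ← hX i j _ h1 e' he', ← hX i j _ h2 e' he']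
  simp only [onLeft, ← LinearMap.comp_apply, ← TensorProduct.map_comp]
  rw [LinearMap.id_comp, LinearMap.add_comp, TensorProduct.map_add_left, LinearMap.add_apply]
  rfl

/-- A map of degree `s` acting on the right factor, described by an adjoint. -/
theorem Represents.ctMap_right (h : DirectSum.IsInternal ℬ) (hX : Represents m ϖ X F)
    {f : D ⊗[k] B →ₗ[k] D ⊗[k] B} {s : Γ}
    (hf : ∀ p, ∀ a ∈ affGrading D ℬ p, f a ∈ affGrading D ℬ (p + s))
    {φ ψ : D →ₗ[k] D} {α β : B → B}
    (hα : ∀ p, ∀ e ∈ ℬ p, α e ∈ ℬ (p + s)) (hβ : ∀ p, ∀ e ∈ ℬ p, β e ∈ ℬ (p + s))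
    (adj : ∀ e, slice D ϖ e ∘ₗ f = φ ∘ₗ slice D ϖ (α e) + ψ ∘ₗ slice D ϖ (β e)) :
    Represents m ϖ (ctMap _ LinearMap.id f X)
      fun e e' => onRight φ (F e (α e')) + onRight ψ (F e (β e')) := by
  intro i j e he e' he'
  beta_reduce
  have hA := affGrading_isInternal (D := D) h
  have hid : ∀ p, ∀ a ∈ affGrading D ℬ p, (LinearMap.id : _ →ₗ[k] D ⊗[k] B) a ∈
      affGrading D ℬ (p + 0) := fun p a ha => by rwa [add_zero]
  obtain ⟨i, rfl⟩ : ∃ i', i = i' + 0 := ⟨i, by abel⟩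
  obtain ⟨j, rfl⟩ : ∃ j', j = j' + s := ⟨j - s, by abel⟩
  have hs : -m - (j + s) + s = -m - j := by abel
  have h1 := hα _ e' he'
  have h2 := hβ _ e' he'
  rw [hs] at h1 h2
  rw [add_zero] at he
  rw [ctMap_apply_of_shift hA hid hf, ← LinearMap.comp_apply, ← TensorProduct.map_comp,
    LinearMap.comp_assoc, LinearMap.comp_assoc, subtype_comp_gproj_of_shift hA hf,
    subtype_comp_gproj_of_shift hA hid, LinearMap.id_comp,
    ← LinearMap.comp_assoc (affGrading D ℬ j).subtype, adj,
    ← hX i j e he _ h1, ← hX i j e he _ h2]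
  simp only [onRight, ← LinearMap.comp_apply, ← TensorProduct.map_comp]
  rw [LinearMap.id_comp, LinearMap.add_comp, TensorProduct.map_add_right, LinearMap.add_apply]
  rfl

section Multiplications

variable (h : IsQuadraticGradedPerm ℬ mul ϖ) (prec succ : D →ₗ[k] D →ₗ[k] D) (x : D) {b : B}
  {s : Γ} (hb : b ∈ ℬ s)

include h hb

theorem mul_shift (p : Γ) (e : B) (he : e ∈ ℬ p) : mul b e ∈ ℬ (p + s) := by
  rw [add_comm]; exact h.mul_mem s p b hb e he

theorem mul_sub_shift (p : Γ) (e : B) (he : e ∈ ℬ p) : mul b e - mul e b ∈ ℬ (p + s) :=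
  sub_mem (mul_shift h hb p e he) (h.mul_mem p s e he b hb)

theorem affMul_shift (p : Γ) (a : D ⊗[k] B) (ha : a ∈ affGrading D ℬ p) :
    affMul prec succ mul (x ⊗ₜ b) a ∈ affGrading D ℬ (p + s) := by
  rw [add_comm]
  exact affMul_mem h.toIsGradedAlg prec succ (tmul_mem_affGrading x hb) ha

theorem affMul_flip_shift (p : Γ) (a : D ⊗[k] B) (ha : a ∈ affGrading D ℬ p) :
    (affMul prec succ mul).flip (x ⊗ₜ b) a ∈ affGrading D ℬ (p + s) :=
  affMul_mem h.toIsGradedAlg prec succ ha (tmul_mem_affGrading x hb)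

theorem Represents.affMul_left (hX : Represents m ϖ X F) :
    Represents m ϖ (ctMap _ (affMul prec succ mul (x ⊗ₜ b)) LinearMap.id X) fun e e' =>
      onLeft (succ x) (F (mul b e) e') + onLeft (prec x) (F (mul b e - mul e b) e') :=
  hX.ctMap_left h.internal (affMul_shift h prec succ x hb) (mul_shift h hb)
    (mul_sub_shift h hb) (slice_comp_affMul h prec succ x b)

theorem Represents.affMul_right (hX : Represents m ϖ X F) :
    Represents m ϖ (ctMap _ LinearMap.id (affMul prec succ mul (x ⊗ₜ b)) X) fun e e' =>
      onRight (succ x) (F e (mul b e')) + onRight (prec x) (F e (mul b e' - mul e' b)) :=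
  hX.ctMap_right h.internal (affMul_shift h prec succ x hb) (mul_shift h hb)
    (mul_sub_shift h hb) (slice_comp_affMul h prec succ x b)

theorem Represents.affMul_flip_left (hX : Represents m ϖ X F) :
    Represents m ϖ (ctMap _ ((affMul prec succ mul).flip (x ⊗ₜ b)) LinearMap.id X) fun e e' =>
      onLeft (succ.flip x) (F (mul b e - mul e b) e') + onLeft (prec.flip x) (F (mul b e) e') :=
  hX.ctMap_left h.internal (affMul_flip_shift h prec succ x hb) (mul_sub_shift h hb)
    (mul_shift h hb) (slice_comp_affMul_flip h prec succ x b)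

theorem Represents.affMul_flip_right (hX : Represents m ϖ X F) :
    Represents m ϖ (ctMap _ LinearMap.id ((affMul prec succ mul).flip (x ⊗ₜ b)) X) fun e e' =>
      onRight (succ.flip x) (F e (mul b e' - mul e' b)) +
        onRight (prec.flip x) (F e (mul b e')) :=
  hX.ctMap_right h.internal (affMul_flip_shift h prec succ x hb) (mul_sub_shift h hb)
    (mul_shift h hb) (slice_comp_affMul_flip h prec succ x b)

end Multiplications

/-- Multiplications by elements that need not be homogeneous are tame, so that the completed
tensor products with the identity are additive in that element. -/
theorem isTame_affMul (h : IsQuadraticGradedPerm ℬ mul ϖ) (prec succ : D →ₗ[k] D →ₗ[k] D)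
    (a : D ⊗[k] B) : IsTame (affGrading D ℬ) (affMul prec succ mul a) := by
  induction a using homogeneous_tmul_induction h.internal with
  | zero => rw [map_zero]; exact IsTame.zero
  | tmul d i b hb =>
    exact IsTame.of_shift (affGrading_isInternal h.internal) (affMul_shift h prec succ d hb)
  | add a a' ha ha' => rw [map_add]; exact ha.add ha'

theorem isTame_affMul_flip (h : IsQuadraticGradedPerm ℬ mul ϖ) (prec succ : D →ₗ[k] D →ₗ[k] D)
    (a : D ⊗[k] B) : IsTame (affGrading D ℬ) ((affMul prec succ mul).flip a) := by
  induction a using homogeneous_tmul_induction h.internal with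
  | zero => rw [map_zero]; exact IsTame.zero
  | tmul d i b hb =>
    exact IsTame.of_shift (affGrading_isInternal h.internal) (affMul_flip_shift h prec succ d hb)
  | add a a' ha ha' => rw [map_add]; exact ha.add ha'

end Represents

/-! ### Contractions of the coproduct of `D ⊗ B` -/

section Coproduct

variable {k : Type*} [Field k] {Γ : Type*}
  {D : Type*} [AddCommGroup D] [Module k D] {B : Type*} [AddCommGroup B] [Module k B]
  {ℬ : Γ → Submodule k B} {ϖ : B →ₗ[k] B →ₗ[k] k}

theorem ctPairingTerm_ctTwist (Y : CTensor ℬ ℬ) (i j : Γ) (e f : B) :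
    ctPairingTerm ℬ ϖ (ctTwist ℬ Y) e f (i, j) = ctPairingTerm ℬ ϖ Y f e (j, i) := by
  simp only [ctPairingTerm, ctTwist]
  generalize Y j i = z
  induction z using TensorProduct.induction_on with
  | zero => simp
  | tmul x y => simp [mul_comm]
  | add x y hx hy => simp only [map_add, hx, hy]

theorem map_slice_bullet (t : D ⊗[k] D) (Y : CTensor ℬ ℬ) (i j : Γ) (e f : B) :
    TensorProduct.map (slice D ϖ e ∘ₗ (affGrading D ℬ i).subtype)
      (slice D ϖ f ∘ₗ (affGrading D ℬ j).subtype) (bullet ℬ t Y i j) =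
      ctPairingTerm ℬ ϖ Y e f (i, j) • t := by
  let ρ : ∀ i, D ⊗[k] ℬ i →ₗ[k] affGrading D ℬ i := fun i =>
    LinearMap.rangeRestrict (TensorProduct.map (LinearMap.id : D →ₗ[k] D) (ℬ i).subtype)
  have hρ : ∀ i e, (slice D ϖ e ∘ₗ (affGrading D ℬ i).subtype) ∘ₗ ρ i =
      slice D ϖ e ∘ₗ TensorProduct.map LinearMap.id (ℬ i).subtype := fun i e => rfl
  change TensorProduct.map _ _ (TensorProduct.map (ρ i) (ρ j)
    (TensorProduct.tensorTensorTensorComm k D D (ℬ i) (ℬ j) (t ⊗ₜ Y i j))) = _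
  rw [← LinearMap.comp_apply, ← TensorProduct.map_comp, hρ, hρ, ctPairingTerm]
  generalize Y i j = z
  induction z using TensorProduct.induction_on with
  | zero => simp
  | tmul x y =>
    induction t using TensorProduct.induction_on with
    | zero => simp
    | tmul d d' => simp [TensorProduct.smul_tmul', TensorProduct.tmul_smul, smul_smul, mul_comm]
    | add t t' ht ht' => simp only [TensorProduct.add_tmul, map_add, ht, ht', smul_add]
  | add x y hx hy => simp only [TensorProduct.tmul_add, map_add, hx, hy, add_smul]

variable [AddCommGroup Γ] [DecidableEq Γ] {mul : B →ₗ[k] B →ₗ[k] B} {m : Γ}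

theorem ctPairingTerm_inducedCoproduct (h : IsQuadraticGradedPerm ℬ mul ϖ)
    (hm : ∀ i j, i + j + m ≠ 0 → ∀ a ∈ ℬ i, ∀ b ∈ ℬ j, ϖ a b = 0) (b : B) {i j : Γ} {e f : B}
    (he : e ∈ ℬ (-m - i)) (hf : f ∈ ℬ (-m - j)) :
    ctPairingTerm ℬ ϖ (inducedCoproduct h b) e f (i, j) = - ϖ b (mul e f) := by
  rw [← inducedCoproduct_spec h, ctPairing_homogeneous hm _ he hf, sub_sub_cancel,
    sub_sub_cancel]

/-- Contracting both legs of the coproduct of `D ⊗ B` with `e` and `f` amounts to contracting its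
argument with `e f` and `f e` and applying `θ_≻` and `θ_≺`. -/
theorem slice_comp_ctComponent (h : IsQuadraticGradedPerm ℬ mul ϖ)
    (hm : ∀ i j, i + j + m ≠ 0 → ∀ a ∈ ℬ i, ∀ b ∈ ℬ j, ϖ a b = 0)
    (θprec θsucc : D →ₗ[k] D ⊗[k] D) {i j : Γ} {e f : B}
    (he : e ∈ ℬ (-m - i)) (hf : f ∈ ℬ (-m - j)) :
    TensorProduct.map (slice D ϖ e ∘ₗ (affGrading D ℬ i).subtype)
      (slice D ϖ f ∘ₗ (affGrading D ℬ j).subtype) ∘ₗ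
        ctComponent _ (affCoproduct ℬ θprec θsucc (inducedCoproduct h)) i j =
      - (θsucc ∘ₗ slice D ϖ (mul e f)) - θprec ∘ₗ slice D ϖ (mul f e) := by
  refine TensorProduct.ext' fun d b => ?_
  have h1 : ctComponent _ (affCoproduct ℬ θprec θsucc (inducedCoproduct h)) i j (d ⊗ₜ b) =
      bullet ℬ (θsucc d) (inducedCoproduct h b) i j +
        bullet ℬ (θprec d) (ctTwist ℬ (inducedCoproduct h b)) i j :=
    congrFun (congrFun (affCoproduct_tmul ℬ θprec θsucc (inducedCoproduct h) d b) i) j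
  rw [LinearMap.comp_apply, h1, map_add, map_slice_bullet, map_slice_bullet,
    ctPairingTerm_ctTwist, ctPairingTerm_inducedCoproduct h hm b he hf,
    ctPairingTerm_inducedCoproduct h hm b hf he]
  simp [sub_eq_add_neg]

theorem represents_affCoproduct (h : IsQuadraticGradedPerm ℬ mul ϖ)
    (hm : ∀ i j, i + j + m ≠ 0 → ∀ a ∈ ℬ i, ∀ b ∈ ℬ j, ϖ a b = 0)
    (θprec θsucc : D →ₗ[k] D ⊗[k] D) (d : D) (b : B) :
    Represents m ϖ (affCoproduct ℬ θprec θsucc (inducedCoproduct h) (d ⊗ₜ b)) fun e f =>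
      - (ϖ b (mul e f) • θsucc d) - ϖ b (mul f e) • θprec d := fun i j e he f hf => by
  have := LinearMap.congr_fun (slice_comp_ctComponent h hm θprec θsucc he hf) (d ⊗ₜ b)
  simp only [LinearMap.comp_apply, LinearMap.sub_apply, LinearMap.neg_apply, slice_tmul,
    map_smul] at this
  exact this

end Coproduct

/-! ### The axioms of an ASI bialgebra on homogeneous pure tensors -/

section Axioms

variable {k : Type*} [Field k] {Γ : Type*} [AddCommGroup Γ] [DecidableEq Γ]
  {D : Type*} [AddCommGroup D] [Module k D] {B : Type*} [AddCommGroup B] [Module k B]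
  {ℬ : Γ → Submodule k B} {mul : B →ₗ[k] B →ₗ[k] B} {ϖ : B →ₗ[k] B →ₗ[k] k}

/-- This and the next three lemmas express all values of the form that occur below through
`ϖ(b, (c f) e)`, `ϖ(b, (c e) f)` and `ϖ(b, (e f) c)`; a product of three elements of a perm algebra
depends only on which factor is the last one. -/
theorem form_mul_mul (h : IsQuadraticGradedPerm ℬ mul ϖ) (b c e f : B) :
    ϖ (mul b c) (mul e f) = ϖ b (mul (mul c e) f) - ϖ b (mul (mul e f) c) := by
  rw [h.invariant, map_sub, h.assoc]

theorem form_mul_mul' (h : IsQuadraticGradedPerm ℬ mul ϖ) (b c e f : B) :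
    ϖ (mul c b) (mul e f) = ϖ b (mul (mul c e) f) := by
  rw [form_mul_left h, h.assoc]

theorem form_swap_last (h : IsQuadraticGradedPerm ℬ mul ϖ) (b c u v : B) :
    ϖ c (mul (mul u v) b) = - ϖ b (mul (mul u v) c) := by
  rw [h.antisymm, form_mul_left h]

theorem form_swap_middle (h : IsQuadraticGradedPerm ℬ mul ϖ) (b c u f : B) :
    ϖ c (mul (mul u b) f) = ϖ b (mul (mul c u) f) - ϖ b (mul (mul f u) c) := by
  rw [h.perm u b, ← h.assoc, ← form_mul_left h, form_mul_mul h, h.perm u f]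

/-- The associator of `D ⊗ B` on pure tensors. -/
theorem affMul_associator (h : IsGradedPerm ℬ mul) (prec succ : D →ₗ[k] D →ₗ[k] D) (x y z : D)
    (a b c : B) :
    affMul prec succ mul (affMul prec succ mul (x ⊗ₜ a) (y ⊗ₜ b)) (z ⊗ₜ c) -
        affMul prec succ mul (x ⊗ₜ a) (affMul prec succ mul (y ⊗ₜ b) (z ⊗ₜ c)) =
      (prec (prec x y) z - (prec x (prec y z) + prec x (succ y z))) ⊗ₜ mul (mul b c) a +
      (prec (succ x y) z - succ x (prec y z)) ⊗ₜ mul (mul a c) b -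
      (succ x (succ y z) - (succ (prec x y) z + succ (succ x y) z)) ⊗ₜ mul (mul a b) c := by
  simp only [affMul_tmul, map_add, LinearMap.add_apply, h.assoc, h.perm b a, h.perm c a,
    h.perm c b, TensorProduct.add_tmul, TensorProduct.sub_tmul]
  abel

variable {m : Γ} (h : IsQuadraticGradedPerm ℬ mul ϖ)
  (hm : ∀ i j, i + j + m ≠ 0 → ∀ a ∈ ℬ i, ∀ b ∈ ℬ j, ϖ a b = 0)
  (prec succ : D →ₗ[k] D →ₗ[k] D) (θprec θsucc : D →ₗ[k] D ⊗[k] D)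

include hm

/-- On homogeneous pure tensors, compatibility of the coproduct with the product says that the
defects of the first, second and fourth conditions on a dendriform `D`-bialgebra, with coefficients
given by the form, cancel. The third condition is a consequence of these three. -/
theorem comul_mul_iff (x y : D) {i j : Γ} {b c : B} (hb : b ∈ ℬ i) (hc : c ∈ ℬ j) :
    affCoproduct ℬ θprec θsucc (inducedCoproduct h) (affMul prec succ mul (x ⊗ₜ b) (y ⊗ₜ c)) =
      ctMap _ ((affMul prec succ mul).flip (y ⊗ₜ c)) LinearMap.id
        (affCoproduct ℬ θprec θsucc (inducedCoproduct h) (x ⊗ₜ b)) +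
      ctMap _ LinearMap.id (affMul prec succ mul (x ⊗ₜ b))
        (affCoproduct ℬ θprec θsucc (inducedCoproduct h) (y ⊗ₜ c)) ↔
    ∀ s t, ∀ e ∈ ℬ s, ∀ f ∈ ℬ t,
      ϖ b (mul (mul c f) e) • (θprec (prec x y + succ x y) -
        (onRight (succ x) (θprec y) + onLeft ((prec + succ).flip y) (θprec x))) +
      ϖ b (mul (mul c e) f) • (θsucc (prec x y + succ x y) -
        (onRight ((prec + succ) x) (θsucc y) + onLeft (prec.flip y) (θsucc x))) -
      ϖ b (mul (mul e f) c) • (θprec (succ x y) + θsucc (succ x y) -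
        (onRight (succ x) ((θprec + θsucc) y) + onLeft (succ.flip y) (θprec x))) = 0 := by
  have hx := represents_affCoproduct h hm θprec θsucc x b
  have hy := represents_affCoproduct h hm θprec θsucc y c
  have hl := (represents_affCoproduct h hm θprec θsucc (succ x y) (mul b c)).add
    (represents_affCoproduct h hm θprec θsucc (prec x y) (mul c b))
  rw [affMul_tmul, map_add, hl.eq_iff h hm ((hx.affMul_flip_left h prec succ y hc).add
    (hy.affMul_right h prec succ x hb))]
  refine forall₂_congr fun s t => forall₂_congr fun e _ => forall₂_congr fun f _ => ?_
  rw [← sub_eq_zero, ← neg_eq_zero]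
  refine Eq.congr ?_ rfl
  have hflip : (prec + succ).flip y = prec.flip y + succ.flip y := rfl
  rw [hflip]
  simp only [form_mul_mul h b c, form_mul_mul' h b c, map_sub, LinearMap.sub_apply, h.assoc,
    TensorProduct.map_add_left, TensorProduct.map_add_right, LinearMap.add_apply, map_add]
  simp only [h.perm e c, h.perm f c, h.perm f e, h.perm b f, sub_self, map_zero,
    zero_smul, neg_zero, form_swap_middle h b c, form_swap_last h b c]
  simp only [map_neg, map_smul]
  module

/-- On homogeneous pure tensors, the antisymmetry condition says that the defects of the fifth
condition for `(x, y)`, of its flip for `(y, x)`, and of the sixth condition for `(y, x)`, with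
coefficients given by the form, cancel. -/
theorem antisymm_iff (x y : D) {i j : Γ} {b c : B} (hb : b ∈ ℬ i) (hc : c ∈ ℬ j) :
    ctMap _ (affMul prec succ mul (x ⊗ₜ b)) LinearMap.id
        (affCoproduct ℬ θprec θsucc (inducedCoproduct h) (y ⊗ₜ c)) -
      ctMap _ LinearMap.id ((affMul prec succ mul).flip (x ⊗ₜ b))
        (affCoproduct ℬ θprec θsucc (inducedCoproduct h) (y ⊗ₜ c)) =
      ctTwist _ (ctMap _ LinearMap.id ((affMul prec succ mul).flip (y ⊗ₜ c))
          (affCoproduct ℬ θprec θsucc (inducedCoproduct h) (x ⊗ₜ b)) -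
        ctMap _ (affMul prec succ mul (y ⊗ₜ c)) LinearMap.id
          (affCoproduct ℬ θprec θsucc (inducedCoproduct h) (x ⊗ₜ b))) ↔
    ∀ s t, ∀ e ∈ ℬ s, ∀ f ∈ ℬ t,
      ϖ b (mul (mul c f) e) • (onLeft ((prec + succ) x) (θprec y) -
          onRight (prec.flip x) (θprec y) -
        - TensorProduct.comm k D D
          (onLeft (succ y) (θsucc x) - onRight ((prec + succ).flip y) (θsucc x))) +
      ϖ b (mul (mul c e) f) • TensorProduct.comm k D D (onLeft ((prec + succ) y) (θprec x) -
          onRight (prec.flip y) (θprec x) -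
        - TensorProduct.comm k D D
          (onLeft (succ x) (θsucc y) - onRight ((prec + succ).flip x) (θsucc y))) -
      ϖ b (mul (mul e f) c) • (onLeft (succ x) ((θprec + θsucc) y) -
          onRight (prec.flip x) ((θprec + θsucc) y) -
        TensorProduct.comm k D D
          (onRight (succ.flip y) (θsucc x) - onLeft (prec y) (θprec x))) = 0 := by
  have hx := represents_affCoproduct h hm θprec θsucc x b
  have hy := represents_affCoproduct h hm θprec θsucc y c
  rw [((hy.affMul_left h prec succ x hb).sub (hy.affMul_flip_right h prec succ x hb)).eq_iff h hm
    ((hx.affMul_flip_right h prec succ y hc).sub (hx.affMul_left h prec succ y hc)).twist]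
  refine forall₂_congr fun s t => forall₂_congr fun e _ => forall₂_congr fun f _ => ?_
  rw [← sub_eq_zero, ← neg_eq_zero]
  refine Eq.congr ?_ rfl
  have hflip : ∀ y, (prec + succ).flip y = prec.flip y + succ.flip y := fun _ => rfl
  have hcomm : ∀ t : D ⊗[k] D,
      TensorProduct.comm k D D (TensorProduct.comm k D D t) = t :=
    fun t => (TensorProduct.comm k D D).symm_apply_apply t
  simp only [hflip, map_sub, LinearMap.sub_apply, h.assoc,
    TensorProduct.map_add_left, TensorProduct.map_add_right, LinearMap.add_apply, map_add]
  simp only [h.perm e c, h.perm f c, h.perm f e, h.perm b f, h.perm b e, sub_self, map_zero,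
    zero_smul, neg_zero, form_swap_middle h b c, form_swap_last h b c]
  simp only [map_add, map_sub, map_neg, map_smul, hcomm]
  module

end Axioms

/-! ### Completed coassociativity -/

section Coassoc

variable {k : Type*} [Field k] {Γ : Type*} [AddCommGroup Γ] [DecidableEq Γ]
  {D : Type*} [AddCommGroup D] [Module k D] {B : Type*} [AddCommGroup B] [Module k B]
  {ℬ : Γ → Submodule k B} {mul : B →ₗ[k] B →ₗ[k] B} {ϖ : B →ₗ[k] B →ₗ[k] k}
  {m : Γ} (h : IsQuadraticGradedPerm ℬ mul ϖ)
  (hm : ∀ i j, i + j + m ≠ 0 → ∀ a ∈ ℬ i, ∀ b ∈ ℬ j, ϖ a b = 0)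
  (θprec θsucc : D →ₗ[k] D ⊗[k] D)

include hm

/-- The coproduct of `D ⊗ B` is homogeneous of degree `-m`. -/
theorem ctComponent_comp_subtype_eq_zero {i j l : Γ} (hl : l ≠ m + i + j) :
    ctComponent _ (affCoproduct ℬ θprec θsucc (inducedCoproduct h)) i j ∘ₗ
      (affGrading D ℬ l).subtype = 0 := by
  refine LinearMap.ext fun a => ((slice_jointlyInjective_component h hm i).map
    (slice_jointlyInjective_component h hm j)) _ fun p => ?_
  have hne : l + (-m - i + (-m - j)) + m ≠ 0 := fun h0 => hl (by
    rw [← sub_eq_zero, ← h0]; abel)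
  have hef := h.mul_mem _ _ _ p.1.2 _ p.2.2
  have hfe := h.mul_mem _ _ _ p.2.2 _ p.1.2
  rw [add_comm] at hfe
  have := LinearMap.congr_fun (slice_comp_ctComponent h hm θprec θsucc p.1.2 p.2.2) (a : D ⊗[k] B)
  refine this.trans ?_
  simp only [LinearMap.sub_apply, LinearMap.neg_apply, LinearMap.comp_apply,
    slice_eq_zero_of_mem hm hne a.2 hef, slice_eq_zero_of_mem hm hne a.2 hfe, map_zero, neg_zero,
    sub_zero]

theorem ctLeftTerm_eq_zero (X : CTensor (affGrading D ℬ) (affGrading D ℬ)) {i j n l : Γ}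
    (hl : l ≠ m + i + j) :
    ctLeftTerm _ (affCoproduct ℬ θprec θsucc (inducedCoproduct h)) X i j n l = 0 := by
  rw [ctLeftTerm, ctComponent_comp_subtype_eq_zero h hm θprec θsucc hl,
    TensorProduct.map_zero_left, LinearMap.zero_apply, map_zero]

theorem ctRightTerm_eq_zero (X : CTensor (affGrading D ℬ) (affGrading D ℬ)) {i j n l : Γ}
    (hl : l ≠ m + j + n) :
    ctRightTerm _ (affCoproduct ℬ θprec θsucc (inducedCoproduct h)) X i j n l = 0 := by
  rw [ctRightTerm, ctComponent_comp_subtype_eq_zero h hm θprec θsucc hl,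
    TensorProduct.map_zero_right, LinearMap.zero_apply]

variable {X : CTensor (affGrading D ℬ) (affGrading D ℬ)} {F : B → B → D ⊗[k] D}

/-- Contraction of `(Δ ⊗̂ id) X`: the contraction with `e ⊗ f` is moved through `Δ` to `X`. -/
theorem map_slice_ctLeftTerm (hX : Represents m ϖ X F) {i j n : Γ} {e f g : B}
    (he : e ∈ ℬ (-m - i)) (hf : f ∈ ℬ (-m - j)) (hg : g ∈ ℬ (-m - n)) :
    TensorProduct.map (slice D ϖ e ∘ₗ (affGrading D ℬ i).subtype)
      (TensorProduct.map (slice D ϖ f ∘ₗ (affGrading D ℬ j).subtype)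
        (slice D ϖ g ∘ₗ (affGrading D ℬ n).subtype))
      (ctLeftTerm _ (affCoproduct ℬ θprec θsucc (inducedCoproduct h)) X i j n (m + i + j)) =
    - tensorLeft θsucc (F (mul e f) g) - tensorLeft θprec (F (mul f e) g) := by
  have hd : -m - i + (-m - j) = -m - (m + i + j) := by abel
  have hef := h.mul_mem _ _ _ he _ hf
  have hfe := h.mul_mem _ _ _ hf _ he
  rw [add_comm (-m - j)] at hfe
  rw [hd] at hef hfe
  rw [← hX _ _ _ hef _ hg, ← hX _ _ _ hfe _ hg, ctLeftTerm, ← LinearEquiv.coe_coe,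
    ← LinearMap.comp_apply, TensorProduct.map_map_comp_assoc_eq, LinearMap.comp_apply,
    ← LinearMap.comp_apply (TensorProduct.map _ _), ← TensorProduct.map_comp,
    ← LinearMap.comp_assoc, slice_comp_ctComponent h hm θprec θsucc he hf]
  generalize X (m + i + j) n = z
  induction z using TensorProduct.induction_on with
  | zero => simp only [map_zero, neg_zero, sub_zero]
  | tmul a a' => simp [tensorLeft, TensorProduct.sub_tmul, TensorProduct.neg_tmul]
  | add z z' hz hz' => simp only [map_add, hz, hz']; abel

/-- Contraction of `(id ⊗̂ Δ) X`: the contraction with `f ⊗ g` is moved through `Δ` to `X`. -/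
theorem map_slice_ctRightTerm (hX : Represents m ϖ X F) {i j n : Γ} {e f g : B}
    (he : e ∈ ℬ (-m - i)) (hf : f ∈ ℬ (-m - j)) (hg : g ∈ ℬ (-m - n)) :
    TensorProduct.map (slice D ϖ e ∘ₗ (affGrading D ℬ i).subtype)
      (TensorProduct.map (slice D ϖ f ∘ₗ (affGrading D ℬ j).subtype)
        (slice D ϖ g ∘ₗ (affGrading D ℬ n).subtype))
      (ctRightTerm _ (affCoproduct ℬ θprec θsucc (inducedCoproduct h)) X i j n (m + j + n)) =
    - tensorRight θsucc (F e (mul f g)) - tensorRight θprec (F e (mul g f)) := by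
  have hd : -m - j + (-m - n) = -m - (m + j + n) := by abel
  have hfg := h.mul_mem _ _ _ hf _ hg
  have hgf := h.mul_mem _ _ _ hg _ hf
  rw [add_comm (-m - n)] at hgf
  rw [hd] at hfg hgf
  rw [← hX _ _ _ he _ hfg, ← hX _ _ _ he _ hgf, ctRightTerm,
    ← LinearMap.comp_apply, ← TensorProduct.map_comp,
    ← LinearMap.comp_assoc, slice_comp_ctComponent h hm θprec θsucc hf hg]
  generalize X i (m + j + n) = z
  induction z using TensorProduct.induction_on with
  | zero => simp only [map_zero, neg_zero, sub_zero]
  | tmul a a' => simp [tensorRight, TensorProduct.tmul_sub, TensorProduct.tmul_neg]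
  | add z z' hz hz' => simp only [map_add, hz, hz']; abel

/-- On pure tensors, coassociativity says that the defects of the three axioms of a dendriform
coalgebra, with coefficients given by the form, cancel. -/
theorem coassoc_iff (d : D) (b : B) :
    (∀ i j n, ctLeftTerm _ (affCoproduct ℬ θprec θsucc (inducedCoproduct h))
        (affCoproduct ℬ θprec θsucc (inducedCoproduct h) (d ⊗ₜ b)) i j n (m + i + j) =
      ctRightTerm _ (affCoproduct ℬ θprec θsucc (inducedCoproduct h))
        (affCoproduct ℬ θprec θsucc (inducedCoproduct h) (d ⊗ₜ b)) i j n (m + j + n)) ↔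
    ∀ s t r, ∀ e ∈ ℬ s, ∀ f ∈ ℬ t, ∀ g ∈ ℬ r,
      ϖ b (mul (mul f g) e) • (tensorLeft θprec (θprec d) -
        (tensorRight θprec (θprec d) + tensorRight θsucc (θprec d))) +
      ϖ b (mul (mul e g) f) • (tensorLeft θsucc (θprec d) - tensorRight θprec (θsucc d)) -
      ϖ b (mul (mul e f) g) • (tensorRight θsucc (θsucc d) -
        (tensorLeft θprec (θsucc d) + tensorLeft θsucc (θsucc d))) = 0 := by
  have hX := represents_affCoproduct h hm θprec θsucc d b
  have key : ∀ {i j n : Γ} {e f g : B}, e ∈ ℬ (-m - i) → f ∈ ℬ (-m - j) → g ∈ ℬ (-m - n) →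
      TensorProduct.map (slice D ϖ e ∘ₗ (affGrading D ℬ i).subtype)
        (TensorProduct.map (slice D ϖ f ∘ₗ (affGrading D ℬ j).subtype)
          (slice D ϖ g ∘ₗ (affGrading D ℬ n).subtype))
        (ctLeftTerm _ (affCoproduct ℬ θprec θsucc (inducedCoproduct h))
          (affCoproduct ℬ θprec θsucc (inducedCoproduct h) (d ⊗ₜ b)) i j n (m + i + j)) -
      TensorProduct.map (slice D ϖ e ∘ₗ (affGrading D ℬ i).subtype)
        (TensorProduct.map (slice D ϖ f ∘ₗ (affGrading D ℬ j).subtype)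
          (slice D ϖ g ∘ₗ (affGrading D ℬ n).subtype))
        (ctRightTerm _ (affCoproduct ℬ θprec θsucc (inducedCoproduct h))
          (affCoproduct ℬ θprec θsucc (inducedCoproduct h) (d ⊗ₜ b)) i j n (m + j + n)) =
      ϖ b (mul (mul f g) e) • (tensorLeft θprec (θprec d) -
        (tensorRight θprec (θprec d) + tensorRight θsucc (θprec d))) +
      ϖ b (mul (mul e g) f) • (tensorLeft θsucc (θprec d) - tensorRight θprec (θsucc d)) -
      ϖ b (mul (mul e f) g) • (tensorRight θsucc (θsucc d) -
        (tensorLeft θprec (θsucc d) + tensorLeft θsucc (θsucc d))) := by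
    intro i j n e f g he hf hg
    rw [map_slice_ctLeftTerm h hm θprec θsucc hX he hf hg,
      map_slice_ctRightTerm h hm θprec θsucc hX he hf hg]
    simp only [h.assoc, h.perm f e, h.perm g e, h.perm g f, map_sub, map_neg, map_smul]
    module
  constructor
  · intro H s t r e he f hf g hg
    rw [← sub_sub_cancel (-m) s] at he
    rw [← sub_sub_cancel (-m) t] at hf
    rw [← sub_sub_cancel (-m) r] at hg
    rw [← key he hf hg, H, sub_self]
  · intro H i j n
    refine ((slice_jointlyInjective_component h hm i).map
      ((slice_jointlyInjective_component h hm j).map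
        (slice_jointlyInjective_component h hm n))).eq fun p => ?_
    rw [← sub_eq_zero]
    exact (key p.1.2 p.2.1.2 p.2.2.2).trans (H _ _ _ _ p.1.2 _ p.2.1.2 _ p.2.2.2)

end Coassoc

/-! ### From dendriform `D`-bialgebras to completed ASI bialgebras and back -/

section Main

variable {k : Type*} [Field k] {Γ : Type*} [AddCommGroup Γ] [DecidableEq Γ]
  {D : Type*} [AddCommGroup D] [Module k D] {B : Type*} [AddCommGroup B] [Module k B]
  {ℬ : Γ → Submodule k B} {mul : B →ₗ[k] B →ₗ[k] B} {ϖ : B →ₗ[k] B →ₗ[k] k}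
  {prec succ : D →ₗ[k] D →ₗ[k] D} {θprec θsucc : D →ₗ[k] D ⊗[k] D}

theorem affMul_assoc (h : IsGradedPerm ℬ mul) (hD : IsDendriform prec succ) (u v w : D ⊗[k] B) :
    affMul prec succ mul (affMul prec succ mul u v) w =
      affMul prec succ mul u (affMul prec succ mul v w) := by
  induction u using TensorProduct.induction_on with
  | zero => simp
  | add u u' hu hu' => simp only [map_add, LinearMap.add_apply, hu, hu']
  | tmul x a =>
    induction v using TensorProduct.induction_on with
    | zero => simp
    | add v v' hv hv' => simp only [map_add, LinearMap.add_apply, hv, hv']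
    | tmul y b =>
      induction w using TensorProduct.induction_on with
      | zero => simp
      | add w w' hw hw' => simp only [map_add, hw, hw']
      | tmul z c =>
        rw [← sub_eq_zero, affMul_associator h, hD.prec_prec, hD.succ_prec, hD.succ_succ]
        simp

theorem affCoproduct_isCompletedCoassociative (h : IsQuadraticGradedPerm ℬ mul ϖ)
    (hD : IsDendriformCoalgebra θprec θsucc) :
    IsCompletedCoassociative (affGrading D ℬ)
      (affCoproduct ℬ θprec θsucc (inducedCoproduct h)) := by
  obtain ⟨m, hm⟩ := h.graded
  refine ⟨fun a i j n => ?_, fun a i j n => ?_, fun a i j n => ?_⟩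
  · refine (Set.finite_singleton (m + i + j)).subset fun l hl => ?_
    by_contra hne
    exact hl (ctLeftTerm_eq_zero h hm θprec θsucc _ hne)
  · refine (Set.finite_singleton (m + j + n)).subset fun l hl => ?_
    by_contra hne
    exact hl (ctRightTerm_eq_zero h hm θprec θsucc _ hne)
  · rw [finsum_eq_single _ _ fun l hl => ctLeftTerm_eq_zero h hm θprec θsucc _ hl,
      finsum_eq_single _ _ fun l hl => ctRightTerm_eq_zero h hm θprec θsucc _ hl]
    induction a using TensorProduct.induction_on with
    | zero => simp [ctLeftTerm, ctRightTerm]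
    | add a a' ha ha' =>
      have hl : ∀ X Y : CTensor (affGrading D ℬ) (affGrading D ℬ),
          ctLeftTerm _ (affCoproduct ℬ θprec θsucc (inducedCoproduct h)) (X + Y) i j n
            (m + i + j) =
          ctLeftTerm _ (affCoproduct ℬ θprec θsucc (inducedCoproduct h)) X i j n (m + i + j) +
          ctLeftTerm _ (affCoproduct ℬ θprec θsucc (inducedCoproduct h)) Y i j n (m + i + j) :=
        fun X Y => by simp only [ctLeftTerm, Pi.add_apply, map_add]
      have hr : ∀ X Y : CTensor (affGrading D ℬ) (affGrading D ℬ),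
          ctRightTerm _ (affCoproduct ℬ θprec θsucc (inducedCoproduct h)) (X + Y) i j n
            (m + j + n) =
          ctRightTerm _ (affCoproduct ℬ θprec θsucc (inducedCoproduct h)) X i j n (m + j + n) +
          ctRightTerm _ (affCoproduct ℬ θprec θsucc (inducedCoproduct h)) Y i j n (m + j + n) :=
        fun X Y => by simp only [ctRightTerm, Pi.add_apply, map_add]
      rw [map_add, hl, hr, ha, ha']
    | tmul d b =>
      refine (coassoc_iff h hm θprec θsucc d b).2 (fun s t r e _ f _ g _ => ?_) i j n
      rw [hD.prec_prec, hD.succ_prec, hD.succ_succ]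
      simp

variable (prec succ) in
theorem ctMap_affMul_left_add (h : IsQuadraticGradedPerm ℬ mul ϖ) (a a' : D ⊗[k] B)
    (X : CTensor (affGrading D ℬ) (affGrading D ℬ)) :
    ctMap _ (affMul prec succ mul (a + a')) LinearMap.id X =
      ctMap _ (affMul prec succ mul a) LinearMap.id X +
        ctMap _ (affMul prec succ mul a') LinearMap.id X := by
  rw [map_add]
  exact ctMap_add_left (isTame_affMul h prec succ a) (isTame_affMul h prec succ a')
    (IsTame.id (affGrading_isInternal h.internal)) X

variable (prec succ) in
theorem ctMap_affMul_right_add (h : IsQuadraticGradedPerm ℬ mul ϖ) (a a' : D ⊗[k] B)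
    (X : CTensor (affGrading D ℬ) (affGrading D ℬ)) :
    ctMap _ LinearMap.id (affMul prec succ mul (a + a')) X =
      ctMap _ LinearMap.id (affMul prec succ mul a) X +
        ctMap _ LinearMap.id (affMul prec succ mul a') X := by
  rw [map_add]
  exact ctMap_add_right (IsTame.id (affGrading_isInternal h.internal))
    (isTame_affMul h prec succ a) (isTame_affMul h prec succ a') X

variable (prec succ) in
theorem ctMap_affMul_flip_left_add (h : IsQuadraticGradedPerm ℬ mul ϖ) (a a' : D ⊗[k] B)
    (X : CTensor (affGrading D ℬ) (affGrading D ℬ)) :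
    ctMap _ ((affMul prec succ mul).flip (a + a')) LinearMap.id X =
      ctMap _ ((affMul prec succ mul).flip a) LinearMap.id X +
        ctMap _ ((affMul prec succ mul).flip a') LinearMap.id X := by
  rw [map_add]
  exact ctMap_add_left (isTame_affMul_flip h prec succ a) (isTame_affMul_flip h prec succ a')
    (IsTame.id (affGrading_isInternal h.internal)) X

variable (prec succ) in
theorem ctMap_affMul_flip_right_add (h : IsQuadraticGradedPerm ℬ mul ϖ) (a a' : D ⊗[k] B)
    (X : CTensor (affGrading D ℬ) (affGrading D ℬ)) :
    ctMap _ LinearMap.id ((affMul prec succ mul).flip (a + a')) X =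
      ctMap _ LinearMap.id ((affMul prec succ mul).flip a) X +
        ctMap _ LinearMap.id ((affMul prec succ mul).flip a') X := by
  rw [map_add]
  exact ctMap_add_right (IsTame.id (affGrading_isInternal h.internal))
    (isTame_affMul_flip h prec succ a) (isTame_affMul_flip h prec succ a') X

theorem isCompletedASIBialgebra_of_isDendriformDBialgebra [FiniteDimensional k D]
    (h : IsQuadraticGradedPerm ℬ mul ϖ) (hD : IsDendriformDBialgebra prec succ θprec θsucc) :
    IsCompletedASIBialgebra (affGrading D ℬ) (affMul prec succ mul)
      (affCoproduct ℬ θprec θsucc (inducedCoproduct h)) := by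
  obtain ⟨m, hm⟩ := h.graded
  have hid := IsTame.id (affGrading_isInternal (D := D) h.internal)
  have hl := isTame_affMul h prec succ
  have hr := isTame_affMul_flip h prec succ
  refine ⟨⟨affGrading_isGradedAlg h.toIsGradedAlg prec succ, affMul_assoc h.toIsGradedPerm hD.alg⟩,
    affCoproduct_isCompletedCoassociative h hD.coalg, fun a₁ a₂ => ?_, fun a₁ a₂ => ?_⟩
  · induction a₁ using homogeneous_tmul_induction h.internal with
    | zero => simp [ctMap_zero, ctMap_zero_right]
    | add u u' hu hu' =>
      rw [ctMap_affMul_right_add prec succ h, map_add, LinearMap.add_apply, map_add, map_add,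
        hu, hu', ctMap_add (hr _) hid, add_add_add_comm]
    | tmul x i b hb =>
      induction a₂ using homogeneous_tmul_induction h.internal with
      | zero => simp [ctMap_zero, ctMap_zero_left]
      | add v v' hv hv' =>
        rw [ctMap_affMul_flip_left_add prec succ h, map_add, map_add, map_add, hv, hv',
          ctMap_add hid (hl _), add_add_add_comm]
      | tmul y j c hc =>
        refine (comul_mul_iff h hm prec succ θprec θsucc x y hb hc).2 fun s t e _ f _ => ?_
        rw [hD.compat₁, hD.compat₂, hD.compat₄]
        simp
  · induction a₁ using homogeneous_tmul_induction h.internal with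
    | zero => simp [ctMap_zero, ctMap_zero_right, ctMap_zero_left, ctensor_sub_self, ctTwist_zero]
    | add u u' hu hu' =>
      rw [ctMap_affMul_left_add prec succ h, ctMap_affMul_flip_right_add prec succ h, map_add,
        ctMap_add (hl _) hid, ctMap_add hid (hr _), ctensor_add_sub_add_comm,
        ctensor_add_sub_add_comm, hu, hu', ctTwist_add]
    | tmul x i b hb =>
      induction a₂ using homogeneous_tmul_induction h.internal with
      | zero => simp [ctMap_zero, ctMap_zero_right, ctMap_zero_left, ctensor_sub_self, ctTwist_zero]
      | add v v' hv hv' =>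
        rw [ctMap_affMul_left_add prec succ h, ctMap_affMul_flip_right_add prec succ h, map_add,
          ctMap_add (hl _) hid, ctMap_add hid (hr _), ctensor_add_sub_add_comm,
          ctensor_add_sub_add_comm, hv, hv', ctTwist_add]
      | tmul y j c hc =>
        refine (antisymm_iff h hm prec succ θprec θsucc x y hb hc).2 fun s t e _ f _ => ?_
        rw [hD.compat₅, hD.compat₅, hD.compat₆]
        simp

section Coefficients

variable {V : Type*} [AddCommGroup V] [Module k V] {a b c : k} {P P' Q R : V}

theorem eq_of_first_coeff (h : a • (P - P') + b • Q - c • R = 0) (ha : a ≠ 0) (hb : b = 0)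
    (hc : c = 0) : P = P' := by
  simpa [hb, hc, ha, sub_eq_zero] using h

theorem eq_of_second_coeff (h : b • Q + a • (P - P') - c • R = 0) (ha : a ≠ 0) (hb : b = 0)
    (hc : c = 0) : P = P' := by
  simpa [hb, hc, ha, sub_eq_zero] using h

theorem eq_of_third_coeff (h : b • Q + c • R - a • (P - P') = 0) (ha : a ≠ 0) (hb : b = 0)
    (hc : c = 0) : P = P' := by
  have h' : a • (P - P') = 0 := by simpa [hb, hc] using h
  simpa [ha, sub_eq_zero] using h'

end Coefficients

/-- The converse for a quadratic perm algebra with homogeneous `b`, `u`, `w` for which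
`ϖ(b, (u u) w) = 1` and `ϖ(b, (u w) u) = 0`: putting `w` in one of three slots and `u` in the two
others isolates each of the three coefficients in the axioms on pure tensors. -/
theorem isDendriformDBialgebra_of_isCompletedASIBialgebra (h : IsQuadraticGradedPerm ℬ mul ϖ)
    {r s t : Γ} {b u w : B} (hb : b ∈ ℬ r) (hu : u ∈ ℬ s) (hw : w ∈ ℬ t)
    (h₁ : ϖ b (mul (mul u u) w) = 1) (h₀ : ϖ b (mul (mul u w) u) = 0)
    (hA : IsCompletedASIBialgebra (affGrading D ℬ) (affMul prec succ mul)
      (affCoproduct ℬ θprec θsucc (inducedCoproduct h))) :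
    IsDendriformDBialgebra prec succ θprec θsucc := by
  obtain ⟨m, hm⟩ := h.graded
  have h₀' : ϖ b (mul (mul w u) u) = 0 := by rw [h.perm, h₀]
  have hassoc := fun x y z (a₁ a₂ a₃ : B) => congrArg (slice D ϖ b)
    ((affMul_associator h.toIsGradedPerm prec succ x y z a₁ a₂ a₃).symm.trans
      (sub_eq_zero.2 (hA.graded_assoc.assoc _ _ _)))
  simp only [map_add, map_sub, slice_tmul, map_zero, h.antisymm _ b] at hassoc
  have hcoassoc := fun d => (coassoc_iff h hm θprec θsucc d b).1 fun i j n => by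
    have := hA.coassoc.coassoc (d ⊗ₜ b) i j n
    rwa [finsum_eq_single _ _ fun l hl => ctLeftTerm_eq_zero h hm θprec θsucc _ hl,
      finsum_eq_single _ _ fun l hl => ctRightTerm_eq_zero h hm θprec θsucc _ hl] at this
  have hcomul := fun x y {j : Γ} {c : B} (hc : c ∈ ℬ j) =>
    (comul_mul_iff h hm prec succ θprec θsucc x y hb hc).1 (hA.comul_mul _ _)
  have hanti := fun x y {j : Γ} {c : B} (hc : c ∈ ℬ j) =>
    (antisymm_iff h hm prec succ θprec θsucc x y hb hc).1 (hA.antisymm _ _)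
  have compat₁ : ∀ x y, θprec (prec x y + succ x y) =
      onRight (succ x) (θprec y) + onLeft ((prec + succ).flip y) (θprec x) := fun x y =>
    eq_of_first_coeff (hcomul x y hu _ _ w hw u hu)
      (by simp [h₁]) (by simp [h₀]) (by simp [h₀'])
  have compat₂ : ∀ x y, θsucc (prec x y + succ x y) =
      onRight ((prec + succ) x) (θsucc y) + onLeft (prec.flip y) (θsucc x) := fun x y =>
    eq_of_second_coeff (hcomul x y hu _ _ u hu w hw)
      (by simp [h₁]) (by simp [h₀]) (by simp [h₀])
  have compat₄ : ∀ x y, θprec (succ x y) + θsucc (succ x y) =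
      onRight (succ x) ((θprec + θsucc) y) + onLeft (succ.flip y) (θprec x) := fun x y =>
    eq_of_third_coeff (hcomul x y hw _ _ u hu u hu)
      (by simp [h₁]) (by simp [h₀']) (by simp [h₀'])
  refine ⟨⟨fun x y z => ?_, fun x y z => ?_, fun x y z => ?_⟩,
    ⟨fun d => ?_, fun d => ?_, fun d => ?_⟩, compat₁, compat₂, fun x y => ?_, compat₄,
    fun x y => ?_, fun x y => ?_⟩
  · exact eq_of_first_coeff (hassoc x y z w u u)
      (by simp [h₁]) (by simp [h₀']) (by simp [h₀'])
  · exact eq_of_second_coeff (hassoc x y z u w u)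
      (by simp [h₁]) (by simp [h₀']) (by simp [h₀])
  · exact eq_of_third_coeff (hassoc x y z u u w)
      (by simp [h₁]) (by simp [h₀]) (by simp [h₀])
  · exact eq_of_first_coeff (hcoassoc d _ _ _ w hw u hu u hu)
      (by simp [h₁]) (by simp [h₀']) (by simp [h₀'])
  · exact eq_of_second_coeff (hcoassoc d _ _ _ u hu w hw u hu)
      (by simp [h₁]) (by simp [h₀']) (by simp [h₀])
  · exact eq_of_third_coeff (hcoassoc d _ _ _ u hu u hu w hw)
      (by simp [h₁]) (by simp [h₀]) (by simp [h₀])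
  · -- the third compatibility is the sum of the first two minus the fourth
    have e₁ := compat₁ x y
    have e₂ := compat₂ x y
    have e₄ := compat₄ x y
    have hflip : (prec + succ).flip y = prec.flip y + succ.flip y := rfl
    rw [hflip] at e₁
    simp only [map_add, TensorProduct.map_add_left, TensorProduct.map_add_right,
      LinearMap.add_apply] at e₁ e₂ e₄ ⊢
    linear_combination (norm := module) e₁ + e₂ - e₄
  · exact eq_of_first_coeff (hanti x y hu _ _ w hw u hu)
      (by simp [h₁]) (by simp [h₀]) (by simp [h₀'])
  · exact eq_of_third_coeff (hanti y x hw _ _ u hu u hu)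
      (by simp [h₁]) (by simp [h₀']) (by simp [h₀'])

/-- The Laurent-polynomial algebra satisfies the hypothesis under which the converse holds. -/
theorem laurent_exists_separating (k : Type*) [Field k] :
    ∃ (r s t : ℤ × ℤ) (b u w : LaurentVF k), b ∈ laurentGrading k r ∧ u ∈ laurentGrading k s ∧
      w ∈ laurentGrading k t ∧ laurentForm k b (laurentMul k (laurentMul k u u) w) = 1 ∧
      laurentForm k b (laurentMul k (laurentMul k u w) u) = 0 := by
  -- `u = ∂₂`, `w = ∂₁` and `b = x₂⁻² ∂₂`
  refine ⟨_, _, _, _, _, _, laurentMonomial_mem k (0, -2) 1, laurentMonomial_mem k 0 1,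
    laurentMonomial_mem k 0 0, ?_, ?_⟩
  · rw [laurentMul_monomial, laurentMul_monomial, (laurentForm_monomial k _ _).1, if_pos]
    simp [expo]
  · rw [laurentMul_monomial, laurentMul_monomial, (laurentForm_monomial k _ _).2.2.2]

end Main

end DendriformASI

end

theorem mainTheorem2 {k : Type*} [Field k] [CharZero k]
    {D : Type*} [AddCommGroup D] [Module k D] [FiniteDimensional k D]
    (prec succ : D →ₗ[k] D →ₗ[k] D) (θprec θsucc : D →ₗ[k] TensorProduct k D D) :
    (∀ {Γ : Type*} [AddCommGroup Γ] [DecidableEq Γ] {B : Type*} [AddCommGroup B] [Module k B]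
        (ℬ : Γ → Submodule k B) (mul : B →ₗ[k] B →ₗ[k] B) (ϖ : B →ₗ[k] B →ₗ[k] k)
        (hB : DendriformASI.IsQuadraticGradedPerm ℬ mul ϖ),
      DendriformASI.IsDendriformDBialgebra prec succ θprec θsucc →
      DendriformASI.IsCompletedASIBialgebra (DendriformASI.affGrading D ℬ)
        (DendriformASI.affMul prec succ mul)
        (DendriformASI.affCoproduct ℬ θprec θsucc (DendriformASI.inducedCoproduct hB))) ∧
    (DendriformASI.IsCompletedASIBialgebra
        (DendriformASI.affGrading D (DendriformASI.laurentGrading k))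
        (DendriformASI.affMul prec succ (DendriformASI.laurentMul k))
        (DendriformASI.affCoproduct (DendriformASI.laurentGrading k) θprec θsucc
          (DendriformASI.inducedCoproduct (DendriformASI.laurent_isQuadratic k))) ↔
      DendriformASI.IsDendriformDBialgebra prec succ θprec θsucc) := by
  refine ⟨fun ℬ mul ϖ hB hD =>
    DendriformASI.isCompletedASIBialgebra_of_isDendriformDBialgebra hB hD, fun hA => ?_,
    DendriformASI.isCompletedASIBialgebra_of_isDendriformDBialgebra _⟩
  obtain ⟨_, _, _, b, u, w, hb, hu, hw, h₁, h₀⟩ := DendriformASI.laurent_exists_separating k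
  exact DendriformASI.isDendriformDBialgebra_of_isCompletedASIBialgebra _ hb hu hw h₁ h₀ hA
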